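/- **Setting.** Let $d\ge 1$ and let $F:\mathbb R^d\to\mathbb R$ satisfy: $F^{\inf}:=\inf F>-\infty$; $F$ is twice continuously differentiable; $\nabla F$ is $L_1$-Lipschitz in the Euclidean norm $\|\cdot\|$ ($L_1\ge 0$); $\nabla^2F$ is $L_2$-Lipschitz in the operator norm $\|\cdot\|_{\rm op}$ ($L_2\ge 0$). Let $\mathcal D$ be a probability distribution, and let $\nabla f(x,\xi)\in\mathbb R^d$, $\nabla^2 f(x,\xi)\in\mathbb R^{d\times d}$ be (jointly measurable) stochastic gradient and Hessian oracles which, for some $p\in(1,2]$, $q\in[1,2]$, $\sigma_1,\sigma_2>0$ and all $x$, satisfy $$\mathbb E_{\xi\sim\mathcal D}[\nabla f(x,\xi)]=\nabla F(x),\quad \mathbb E_{\xi\sim\mathcal D}\|\nabla f(x,\xi)-\nabla F(x)\|^p\le\sigma_1^p,$$ $$\mathbb E_{\xi\sim\mathcal D}[\nabla^2 f(x,\xi)]=\nabla^2F(x),\quad \mathbb E_{\xi\sim\mathcal D}\|\nabla^2 f(x,\xi)-\nabla^2F(x)\|_{\rm op}^q\le\sigma_2^q .$$ **Algorithm (Clipped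 NSGD-Hess).** Put $\mathrm{clip}(v,\lambda)=\min\{1,\lambda/\|v\|\}\,v$ for $v\ne0$, $\mathrm{clip}(0,\lambda)=0$, and $0/\|0\|:=0$. Given $x_0\in\mathbb R^d$, $g_0=0$, a stepsize $\gamma>0$, $\alpha\in(0,1]$ and thresholds $\lambda_1,\lambda_2>0$, let $x_1=x_0-\gamma g_0/\|g_0\|=x_0$ and, for $t=1,2,\dots$, $$\hat x_t=u_tx_t+(1-u_t)x_{t-1},$$ $$g_t=(1-\alpha)\bigl(g_{t-1}+\mathrm{clip}(\nabla^2 f(\hat x_t,\hat\xi_t)(x_t-x_{t-1}),\lambda_1)\bigr)+\alpha\,\mathrm{clip}(\nabla f(x_t,\xi_t),\lambda_2),\qquad x_{t+1}=x_t-\gamma\frac{g_t}{\|g_t\|},$$ where all the random variables $u_t\sim\mathcal U([0,1])$, $\xi_t\sim\mathcal D$, $\hat\xi_t\sim\mathcal D$ ($t\ge1$) are independent. **Parameters.** Let $T\ge1$ be an integer, $\beta\in(0,1]$, $\Delta:=F(x_0)-F^{\inf}$, and let $\ell:=\log\frac{8T}{\beta}$; if $T/\beta\ge2$, one may take $\ell:=\log\frac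 T\beta$ instead. Put $$\alpha=\max\Bigl\{T^{-\frac p{2p-1}},\,T^{-\frac{pq}{p(2q+1)-2q}}\Bigr\},\quad \lambda_1=\max\bigl\{2\gamma L_1,\gamma\sigma_2\alpha^{-1/q}\bigr\},\quad \lambda_2=\max\bigl\{4\sqrt{L_1\Delta},\sigma_1\alpha^{-1/p}\bigr\},$$ $$M=\min\left\{\alpha\sqrt{\tfrac{\Delta}{L_1}},\ \sqrt[3]{\tfrac{\Delta\alpha}{L_2T}},\ \tfrac1{\alpha T\ell}\sqrt{\tfrac{\Delta}{L_1}},\ \tfrac{\Delta}{\sigma_1\alpha^{(p-1)/p}T\ell},\ \sqrt{\tfrac{\Delta\alpha^{1/q}}{\sigma_2T\ell}},\ \sqrt{\tfrac{\Delta}{L_1T\ell}}\right\},$$ where, if $L_1=0$ or $L_2=0$, the terms having it in the denominator are omitted; if $\Delta=0$, put $M=0$. **Theorem.** There are universal constants $c_0,C>0$ such that, in the setting above, for every $c\in(0,c_0]$, if the algorithm is run with $g_0=0$, the above $\alpha,\lambda_1,\lambda_2$ and stepsize $\gamma=cM$, and $\gamma>0$, then with probability at least $1-\beta$ both $$\frac1T\sum_{t=0}^{T-1}\|\nabla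 F(x_t)\|\le\frac{2\Delta}{\gamma T}$$ and $$\frac1T\sum_{t=0}^{T-1}\|\nabla F(x_t)\|\le\frac Cc\left(\frac{(L_2^{1/2}\Delta)^{2/3}}{T^{\frac{2(p-1)}{4p-3}}}+\frac{\sqrt{L_1\Delta}+\sigma_1}{T^{\min\left\{\frac{p-1}{2p-1},\frac{q(p-1)}{p(2q+1)-2q}\right\}}}\,\ell+\frac{\sqrt{\sigma_2\Delta}}{T^{\frac{q(p-1)}{p(2q+1)-2q}}}\sqrt{\ell}\right).$$ -/

import Mathlib

open MeasureTheory ProbabilityTheory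

noncomputable section

namespace ClippedHess

/-- The Hessian of `F` at `x`, as a continuous linear map (so its norm is the operator norm). -/
def hessian {d : ℕ} (F : EuclideanSpace ℝ (Fin d) → ℝ) (x : EuclideanSpace ℝ (Fin d)) :
    EuclideanSpace ℝ (Fin d) →L[ℝ] EuclideanSpace ℝ (Fin d) :=
  fderiv ℝ (gradient F) x

/-- `F` is differentiable and its gradient is `L`-Lipschitz. -/
def GradientLipschitz {d : ℕ} (F : EuclideanSpace ℝ (Fin d) → ℝ) (L : ℝ) : Prop :=
  Differentiable ℝ F ∧ ∀ x y, ‖gradient F x - gradient F y‖ ≤ L * ‖x - y‖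

/-- `F` is twice continuously differentiable and its Hessian is `L`-Lipschitz in operator norm. -/
def HessianLipschitz {d : ℕ} (F : EuclideanSpace ℝ (Fin d) → ℝ) (L : ℝ) : Prop :=
  ContDiff ℝ 2 F ∧ ∀ x y, ‖hessian F x - hessian F y‖ ≤ L * ‖x - y‖

/-- The stochastic gradient `G x ξ`, with `ξ` of law `D`, is an unbiased (and jointly measurable)
estimator of the gradient of `F` whose `p`-th central moment is at most `σ ^ p`. -/
structure GradientBCM {d : ℕ} {Ξ : Type*} [MeasurableSpace Ξ] (D : Measure Ξ)
    (F : EuclideanSpace ℝ (Fin d) → ℝ)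
    (G : EuclideanSpace ℝ (Fin d) → Ξ → EuclideanSpace ℝ (Fin d)) (p σ : ℝ) : Prop where
  measurable : Measurable (Function.uncurry G)
  integrable : ∀ x, Integrable (G x) D
  unbiased : ∀ x, ∫ ξ, G x ξ ∂D = gradient F x
  integrable_moment : ∀ x, Integrable (fun ξ => ‖G x ξ - gradient F x‖ ^ p) D
  moment_le : ∀ x, ∫ ξ, ‖G x ξ - gradient F x‖ ^ p ∂D ≤ σ ^ p

/-- The stochastic Hessian `H x ξ`, with `ξ` of law `D`, is an unbiased (and jointly measurable)
estimator of the Hessian of `F` whose `q`-th central moment in operator norm is at most `σ ^ q`. -/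
structure HessianBCM {d : ℕ} {Ξ : Type*} [MeasurableSpace Ξ] (D : Measure Ξ)
    (F : EuclideanSpace ℝ (Fin d) → ℝ)
    (H : EuclideanSpace ℝ (Fin d) → Ξ →
      (EuclideanSpace ℝ (Fin d) →L[ℝ] EuclideanSpace ℝ (Fin d))) (q σ : ℝ) : Prop where
  measurable : Measurable (Function.uncurry H)
  integrable : ∀ x, Integrable (H x) D
  unbiased : ∀ x, ∫ ξ, H x ξ ∂D = hessian F x
  integrable_moment : ∀ x, Integrable (fun ξ => ‖H x ξ - hessian F x‖ ^ q) D
  moment_le : ∀ x, ∫ ξ, ‖H x ξ - hessian F x‖ ^ q ∂D ≤ σ ^ q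

/-- The samples `(u t, ξ t, ξ' t)` are independent over `t`, and for each `t` the three components
are independent, `u t` uniform on `[0, 1]` and `ξ t`, `ξ' t` both of law `D`. -/
structure Sampling {Ω Ξ : Type*} [MeasurableSpace Ω] [MeasurableSpace Ξ] (P : Measure Ω)
    (D : Measure Ξ) (u : ℕ → Ω → ℝ) (ξ ξ' : ℕ → Ω → Ξ) : Prop where
  measurable_u : ∀ t, Measurable (u t)
  measurable_grad : ∀ t, Measurable (ξ t)
  measurable_hess : ∀ t, Measurable (ξ' t)
  law : ∀ t, P.map (fun ω => (u t ω, ξ t ω, ξ' t ω)) =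
    (volume.restrict (Set.Icc (0 : ℝ) 1)).prod (D.prod D)
  indep : iIndepFun (fun t ω => (u t ω, ξ t ω, ξ' t ω)) P

/-- Clipping at level `lam`; it fixes the zero vector. -/
def clip {d : ℕ} (v : EuclideanSpace ℝ (Fin d)) (lam : ℝ) : EuclideanSpace ℝ (Fin d) :=
  min 1 (lam / ‖v‖) • v

/-- One normalized step `x - γ g / ‖g‖`, with the convention `0 / ‖0‖ = 0`. -/
def normalizedStep {d : ℕ} (γ : ℝ) (x g : EuclideanSpace ℝ (Fin d)) : EuclideanSpace ℝ (Fin d) :=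
  x - γ • (‖g‖⁻¹ • g)

/-- Clipped normalized SGD with Hessian-corrected momentum, run with the gradient oracle `G`, the
Hessian oracle `H`, and the samples `u t`, `ξ t`, `ξ' t` for `t = 1, 2, …`.
The value at `t` is the triple `(x t, x (t + 1), g t)`. -/
def run {d : ℕ} {Ξ : Type*} (G : EuclideanSpace ℝ (Fin d) → Ξ → EuclideanSpace ℝ (Fin d))
    (H : EuclideanSpace ℝ (Fin d) → Ξ →
      (EuclideanSpace ℝ (Fin d) →L[ℝ] EuclideanSpace ℝ (Fin d)))
    (γ α lam₁ lam₂ : ℝ) (x₀ g₀ : EuclideanSpace ℝ (Fin d)) (u : ℕ → ℝ) (ξ ξ' : ℕ → Ξ) :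
    ℕ → EuclideanSpace ℝ (Fin d) × EuclideanSpace ℝ (Fin d) × EuclideanSpace ℝ (Fin d)
  | 0 => (x₀, normalizedStep γ x₀ g₀, g₀)
  | t + 1 =>
    let s := run G H γ α lam₁ lam₂ x₀ g₀ u ξ ξ' t
    let xPrev := s.1
    let x := s.2.1
    let gPrev := s.2.2
    let xHat := u (t + 1) • x + (1 - u (t + 1)) • xPrev
    let g := (1 - α) • (gPrev + clip (H xHat (ξ' (t + 1)) (x - xPrev)) lam₁)
      + α • clip (G x (ξ (t + 1))) lam₂
    (x, normalizedStep γ x g, g)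

/-- The iterate `x t` of the algorithm. -/
def iterate {d : ℕ} {Ξ : Type*} (G : EuclideanSpace ℝ (Fin d) → Ξ → EuclideanSpace ℝ (Fin d))
    (H : EuclideanSpace ℝ (Fin d) → Ξ →
      (EuclideanSpace ℝ (Fin d) →L[ℝ] EuclideanSpace ℝ (Fin d)))
    (γ α lam₁ lam₂ : ℝ) (x₀ g₀ : EuclideanSpace ℝ (Fin d)) (u : ℕ → ℝ) (ξ ξ' : ℕ → Ξ) (t : ℕ) :
    EuclideanSpace ℝ (Fin d) :=
  (run G H γ α lam₁ lam₂ x₀ g₀ u ξ ξ' t).1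

/-- The momentum parameter `α`. -/
def momentum (p q : ℝ) (T : ℕ) : ℝ :=
  max ((T : ℝ) ^ (-(p / (2 * p - 1)))) ((T : ℝ) ^ (-(p * q / (p * (2 * q + 1) - 2 * q))))

/-- The minimum of the six quantities
`α √(Δ / L₁)`, `(Δ α / (L₂ T)) ^ (1 / 3)`, `√(Δ / L₁) / (α T ℓ)`,
`Δ / (σ₁ α ^ ((p - 1) / p) T ℓ)`, `√(Δ α ^ (1 / q) / (σ₂ T ℓ))`, `√(Δ / (L₁ T ℓ))`,
written as the reciprocal of the maximum of their reciprocals, so that a quantity with `L₁ = 0` or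
`L₂ = 0` in its denominator counts as `+∞`, that is, imposes nothing. -/
def stepScale (L₁ L₂ σ₁ σ₂ Δ p q α ℓ : ℝ) (T : ℕ) : ℝ :=
  (max (√(L₁ / Δ) / α)
    (max ((L₂ * T / (Δ * α)) ^ ((1 : ℝ) / 3))
      (max (α * T * ℓ * √(L₁ / Δ))
        (max (σ₁ * α ^ ((p - 1) / p) * T * ℓ / Δ)
          (max (√(σ₂ * T * ℓ / (Δ * α ^ (1 / q))))
            (√(L₁ * T * ℓ / Δ)))))))⁻¹

/-- The convergence rate. -/
def rate (L₁ L₂ σ₁ σ₂ Δ p q ℓ : ℝ) (T : ℕ) : ℝ :=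
  (L₂ ^ ((1 : ℝ) / 2) * Δ) ^ ((2 : ℝ) / 3) / (T : ℝ) ^ (2 * (p - 1) / (4 * p - 3))
    + (√(L₁ * Δ) + σ₁)
        / (T : ℝ) ^ (min ((p - 1) / (2 * p - 1)) (q * (p - 1) / (p * (2 * q + 1) - 2 * q))) * ℓ
    + √(σ₂ * Δ) / (T : ℝ) ^ (q * (p - 1) / (p * (2 * q + 1) - 2 * q)) * √ℓ

end ClippedHess

end

/-! The normalized step decreases `F` by `γ‖∇F(x_t)‖`, up to `2γ` times the momentum error and a
term of order `L₁γ²`. Everything therefore rests on controlling `g_t - ∇F(x_t)` uniformly in `t <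
T`.

That error obeys a linear recursion with contraction `1 - α`. It splits into the initial error `(1 -
α)^t ‖∇F(x_0)‖`, a deterministic Taylor remainder of total size `L₂γ²/α`, and the random sum
`noiseSum` (`norm_momentum_error_le`). The Taylor bound holds for the Hessian at any point of the
segment, so each `u_t` can be frozen and the Hessian noise centred at the Hessian of the sampled
point.

Clipping turns the moment bounds into noise that is bounded, with mean of order `αR` and second
moment of order `αR²`, where `R = lam₁ + α lam₂`. The function `exp √(1 + ‖x‖²)` then grows by a
factor at most `exp(8αλR)` per step when the noise is scaled by `λ ≤ 1/(3R)`. The contraction by `1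
- α` absorbs this growth, so the exponential moment stays bounded independently of `t` and of the
dimension (`lintegral_potential_le_of_recursion`). Each sum thus exceeds a multiple of `Rℓ` with
probability at most `exp(-ℓ)`, and a union bound covers all `t < T`.

The clipping estimates need `‖∇F(x_t)‖ ≤ lam₂/2`, which is not known in advance. The gradient noise
is therefore replaced by zero when this fails, and the tail bound needs no conditioning. On the good
event a strong induction shows that the replacement never occurs: the descent bound keeps `F(x_t) -
inf F ≤ 2Δ`, hence `‖∇F(x_t)‖ ≤ 2√(L₁Δ)` (`sum_norm_gradient_le`). The stepsize makes the total
error at most `Δ` (`total_error_le`), and the choice of `α` converts `2Δ/(γT)` into the rate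
(`gap_mul_inv_stepScale_le`). -/

noncomputable section

namespace ClippedHess

open scoped RealInnerProductSpace ENNReal

/-! ### Bias and second moment of clipped random vectors. -/

section Clip

variable {d : ℕ}

lemma clip_eq_self {v : EuclideanSpace ℝ (Fin d)} {lam : ℝ} (h : ‖v‖ ≤ lam) :
    clip v lam = v := by
  rcases eq_or_ne v 0 with rfl | hv
  · simp [clip]
  · have hv' : 0 < ‖v‖ := norm_pos_iff.2 hv
    rw [clip, min_eq_left ((one_le_div hv').2 h), one_smul]

lemma clip_eq_smul {v : EuclideanSpace ℝ (Fin d)} {lam : ℝ} (hl : 0 ≤ lam) (h : lam < ‖v‖) :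
    clip v lam = (lam / ‖v‖) • v := by
  have hv' : 0 < ‖v‖ := hl.trans_lt h
  rw [clip, min_eq_right ((div_le_one hv').2 h.le)]

lemma norm_clip_le (v : EuclideanSpace ℝ (Fin d)) {lam : ℝ} (hl : 0 ≤ lam) :
    ‖clip v lam‖ ≤ lam := by
  rcases le_or_gt ‖v‖ lam with h | h
  · rwa [clip_eq_self h]
  · have hv' : 0 < ‖v‖ := hl.trans_lt h
    rw [clip_eq_smul hl h, norm_smul, Real.norm_of_nonneg (by positivity),
      div_mul_cancel₀ _ hv'.ne']

lemma norm_clip_sub_self_le (v : EuclideanSpace ℝ (Fin d)) {lam : ℝ} (hl : 0 ≤ lam) :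
    ‖clip v lam - v‖ ≤ max 0 (‖v‖ - lam) := by
  rcases le_or_gt ‖v‖ lam with h | h
  · simp [clip_eq_self h]
  · have hv' : 0 < ‖v‖ := hl.trans_lt h
    refine le_trans (le_of_eq ?_) (le_max_right _ _)
    have : (lam / ‖v‖) • v - v = -((1 - lam / ‖v‖) • v) := by rw [sub_smul, one_smul]; abel
    rw [clip_eq_smul hl h, this, norm_neg, norm_smul,
      Real.norm_of_nonneg (sub_nonneg.2 ((div_le_one hv').2 h.le))]
    field_simp

lemma measurable_clip (lam : ℝ) :
    Measurable (fun v : EuclideanSpace ℝ (Fin d) => clip v lam) := by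
  unfold clip
  fun_prop

lemma norm_clip_sub_le {v m : EuclideanSpace ℝ (Fin d)} {lam : ℝ} (hl : 0 ≤ lam)
    (hm : ‖m‖ ≤ lam / 2) : ‖clip v lam - m‖ ≤ 3 / 2 * lam := by
  have := norm_sub_le (clip v lam) m
  have := norm_clip_le v hl
  linarith

/-- The bias of clipping is controlled by any moment of order in `[1, 2]`. -/
lemma norm_clip_sub_self_le_rpow {v m : EuclideanSpace ℝ (Fin d)} {lam r : ℝ} (hl : 0 < lam)
    (hm : ‖m‖ ≤ lam / 2) (hr : 1 ≤ r) (hr2 : r ≤ 2) :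
    ‖clip v lam - v‖ ≤ 2 * lam * (‖v - m‖ / lam) ^ r := by
  have h1 := norm_clip_sub_self_le v hl.le
  have h2 : ‖v‖ ≤ ‖v - m‖ + ‖m‖ := by simpa using norm_add_le (v - m) m
  rcases le_or_gt ‖v‖ lam with h | h
  · rw [max_eq_left (by linarith)] at h1
    exact h1.trans (by positivity)
  · rw [max_eq_right (by linarith)] at h1
    set ρ := ‖v - m‖ / lam with hρ
    have hρl : ‖v - m‖ = ρ * lam := by rw [hρ]; field_simp
    -- Clipping acts only if `‖v‖ > lam`, and `‖m‖ ≤ lam / 2` then forces a deviation of at least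
    -- `lam / 2`. A quantity that is at least 1 is bounded by its `r`-th power.
    have hρ1 : 1 ≤ 2 * ρ := by
      rw [hρl] at h2
      by_contra hc
      nlinarith
    have h3 : 2 * ρ ≤ (2 * ρ) ^ r := Real.self_le_rpow_of_one_le hρ1 hr
    rw [Real.mul_rpow (by norm_num) (by linarith)] at h3
    have h4 : (2 : ℝ) ^ r ≤ 4 := by
      calc (2 : ℝ) ^ r ≤ 2 ^ (2 : ℝ) := Real.rpow_le_rpow_of_exponent_le (by norm_num) hr2
        _ = 4 := by norm_num
    have h5 : 0 ≤ ρ ^ r := Real.rpow_nonneg (by linarith) _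
    have h6 : ρ ≤ 2 * ρ ^ r := by nlinarith
    calc ‖clip v lam - v‖ ≤ ρ * lam := by rw [← hρl]; linarith
      _ ≤ 2 * ρ ^ r * lam := by gcongr
      _ = _ := by ring

/-- The second moment after clipping is controlled by any moment of order in `[1, 2]`. -/
lemma norm_clip_sub_sq_le_rpow {v m : EuclideanSpace ℝ (Fin d)} {lam r : ℝ} (hl : 0 < lam)
    (hm : ‖m‖ ≤ lam / 2) (hr : 1 ≤ r) (hr2 : r ≤ 2) :
    ‖clip v lam - m‖ ^ 2 ≤ 4 * lam ^ 2 * (‖v - m‖ / lam) ^ r := by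
  have h1 := norm_clip_sub_self_le v hl.le
  have h2 : ‖v‖ ≤ ‖v - m‖ + ‖m‖ := by simpa using norm_add_le (v - m) m
  have h3 := norm_clip_sub_le (v := v) hl.le hm
  set ρ := ‖v - m‖ / lam with hρ
  have hρ0 : 0 ≤ ρ := by positivity
  have hρl : ‖v - m‖ = ρ * lam := by rw [hρ]; field_simp
  rcases le_or_gt 1 ρ with h | h
  · have : 1 ≤ ρ ^ r := Real.one_le_rpow h (by linarith)
    calc ‖clip v lam - m‖ ^ 2 ≤ (2 * lam) ^ 2 := by gcongr; linarith
      _ = 4 * lam ^ 2 * 1 := by ring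
      _ ≤ _ := by gcongr
  · have h4 : ‖clip v lam - m‖ ≤ 2 * (ρ * lam) := by
      have h5 : ‖clip v lam - m‖ ≤ ‖clip v lam - v‖ + ‖v - m‖ := by
        simpa using norm_add_le (clip v lam - v) (v - m)
      have : max 0 (‖v‖ - lam) ≤ ‖v - m‖ := max_le (norm_nonneg _) (by linarith)
      linarith
    have h6 : ρ ^ 2 ≤ ρ ^ r := by
      rw [← Real.rpow_natCast]
      exact Real.rpow_le_rpow_of_exponent_ge_of_imp hρ0 h.le (by simpa using hr2)
        (fun _ h0 => by norm_num at h0)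
    calc ‖clip v lam - m‖ ^ 2 ≤ (2 * (ρ * lam)) ^ 2 := by gcongr
      _ = 4 * lam ^ 2 * ρ ^ 2 := by ring
      _ ≤ _ := by gcongr

variable {Z : Type*} [MeasurableSpace Z] {ν : Measure Z} [IsProbabilityMeasure ν]

lemma integrable_of_norm_le {E : Type*} [NormedAddCommGroup E] {f : Z → E}
    (hf : AEStronglyMeasurable f ν) {K : ℝ} (hK : ∀ z, ‖f z‖ ≤ K) : Integrable f ν :=
  Integrable.of_bound hf K (.of_forall hK)

/-- Unbiasedness of `X` reduces the bias to the clipped-off part, which is bounded pointwise by the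
`r`-th moment. The majorant `g` is kept separate because the Hessian oracle is controlled only
through its operator norm. -/
lemma norm_integral_clip_sub_le {X : Z → EuclideanSpace ℝ (Fin d)} {g : Z → ℝ}
    {m : EuclideanSpace ℝ (Fin d)} {lam r α : ℝ} (hl : 0 < lam) (hm : ‖m‖ ≤ lam / 2)
    (hr : 1 ≤ r) (hr2 : r ≤ 2) (hX : Integrable X ν) (hXm : ∫ z, X z ∂ν = m)
    (hg : Integrable g ν) (hXg : ∀ z, ‖X z - m‖ ^ r ≤ g z) (hgα : ∫ z, g z ∂ν ≤ α * lam ^ r) :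
    ‖∫ z, (clip (X z) lam - m) ∂ν‖ ≤ 2 * α * lam := by
  have hcl : Integrable (fun z => clip (X z) lam) ν :=
    integrable_of_norm_le ((measurable_clip lam).comp_aemeasurable hX.aemeasurable
      |>.aestronglyMeasurable) (fun z => norm_clip_le _ hl.le)
  have h1 : ∫ z, (clip (X z) lam - m) ∂ν = ∫ z, (clip (X z) lam - X z) ∂ν := by
    rw [integral_sub hcl (integrable_const _), integral_sub hcl hX, hXm]
    simp
  rw [h1]
  have hp : 0 < lam ^ r := Real.rpow_pos_of_pos hl _
  calc ‖∫ z, (clip (X z) lam - X z) ∂ν‖ ≤ ∫ z, 2 * lam / lam ^ r * g z ∂ν := by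
        refine norm_integral_le_of_norm_le (hg.const_mul _) (.of_forall fun z => ?_)
        refine (norm_clip_sub_self_le_rpow hl hm hr hr2).trans ?_
        rw [Real.div_rpow (norm_nonneg _) hl.le]
        calc 2 * lam * (‖X z - m‖ ^ r / lam ^ r) = 2 * lam / lam ^ r * ‖X z - m‖ ^ r := by ring
          _ ≤ _ := by gcongr; exact hXg z
    _ = 2 * lam / lam ^ r * ∫ z, g z ∂ν := integral_const_mul _ _
    _ ≤ 2 * lam / lam ^ r * (α * lam ^ r) := by gcongr
    _ = _ := by field_simp

omit [IsProbabilityMeasure ν] in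
lemma integral_norm_clip_sub_sq_le {X : Z → EuclideanSpace ℝ (Fin d)} {g : Z → ℝ}
    {m : EuclideanSpace ℝ (Fin d)} {lam r α : ℝ} (hl : 0 < lam) (hm : ‖m‖ ≤ lam / 2)
    (hr : 1 ≤ r) (hr2 : r ≤ 2)
    (hg : Integrable g ν) (hXg : ∀ z, ‖X z - m‖ ^ r ≤ g z) (hgα : ∫ z, g z ∂ν ≤ α * lam ^ r) :
    ∫ z, ‖clip (X z) lam - m‖ ^ 2 ∂ν ≤ 4 * α * lam ^ 2 := by
  have hp : 0 < lam ^ r := Real.rpow_pos_of_pos hl _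
  calc ∫ z, ‖clip (X z) lam - m‖ ^ 2 ∂ν ≤ ∫ z, 4 * lam ^ 2 / lam ^ r * g z ∂ν := by
        refine integral_mono_of_nonneg (.of_forall fun z => by positivity) (hg.const_mul _)
          (.of_forall fun z => ?_)
        refine (norm_clip_sub_sq_le_rpow hl hm hr hr2).trans ?_
        rw [Real.div_rpow (norm_nonneg _) hl.le]
        calc 4 * lam ^ 2 * (‖X z - m‖ ^ r / lam ^ r)
            = 4 * lam ^ 2 / lam ^ r * ‖X z - m‖ ^ r := by ring
          _ ≤ _ := mul_le_mul_of_nonneg_left (hXg z) (by positivity)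
    _ = 4 * lam ^ 2 / lam ^ r * ∫ z, g z ∂ν := integral_const_mul _ _
    _ ≤ 4 * lam ^ 2 / lam ^ r * (α * lam ^ r) := mul_le_mul_of_nonneg_left hgα (by positivity)
    _ = _ := by field_simp

end Clip

/-! ### An exponential potential with a dimension-free one-step bound. -/

section Potential

variable {E : Type*} [NormedAddCommGroup E] [InnerProductSpace ℝ E]

/-- A smooth radial function of exponential growth. -/
def potential (x : E) : ℝ := Real.exp √(1 + ‖x‖ ^ 2)

omit [InnerProductSpace ℝ E] in
lemma one_le_sqrt_one_add_sq (x : E) : 1 ≤ √(1 + ‖x‖ ^ 2) :=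
  Real.one_le_sqrt.2 (by nlinarith [sq_nonneg ‖x‖])

omit [InnerProductSpace ℝ E] in
lemma norm_le_sqrt_one_add_sq (x : E) : ‖x‖ ≤ √(1 + ‖x‖ ^ 2) :=
  Real.le_sqrt_of_sq_le (by linarith)

/-- This is the second-order bound for a function with gradient `x / √(1 + ‖x‖²)` and Hessian at
most the identity. It follows by squaring, since the square root is at least 1. -/
lemma sqrt_one_add_norm_add_sq_le (x θ : E) :
    √(1 + ‖x + θ‖ ^ 2) ≤
      √(1 + ‖x‖ ^ 2) + (⟪(√(1 + ‖x‖ ^ 2))⁻¹ • x, θ⟫ + ‖θ‖ ^ 2 / 2) := by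
  have hN := one_le_sqrt_one_add_sq x
  have hN2 : √(1 + ‖x‖ ^ 2) ^ 2 = 1 + ‖x‖ ^ 2 := Real.sq_sqrt (by positivity)
  have hxN := norm_le_sqrt_one_add_sq x
  set N := √(1 + ‖x‖ ^ 2)
  rw [inner_smul_left]
  have hin : |⟪x, θ⟫| ≤ ‖x‖ * ‖θ‖ := abs_real_inner_le_norm x θ
  set a := ⟪x, θ⟫
  have ha := (abs_le.1 hin).1
  have haN : -(N * ‖θ‖) ≤ a := by nlinarith [norm_nonneg θ]
  have hNa : N * (N⁻¹ * a) = a := by field_simp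
  simp only [conj_trivial]
  set b := N⁻¹ * a
  have hb : -‖θ‖ ≤ b := by nlinarith
  refine Real.sqrt_le_iff.2 ⟨by nlinarith [sq_nonneg (‖θ‖ - 1)], ?_⟩
  rw [norm_add_sq_real]
  change 1 + (‖x‖ ^ 2 + 2 * a + ‖θ‖ ^ 2) ≤ _
  nlinarith [sq_nonneg (b + ‖θ‖ ^ 2 / 2), sq_nonneg ‖θ‖]

/-- With `y` the increment of the exponent, `|y| ≤ 5/4 ‖θ‖ ≤ 1` and `exp y ≤ 1 + y + y²`. The
constant is `1/2 + (5/4)² = 33/16`. -/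
lemma potential_add_le {x θ : E} (hθ : ‖θ‖ ≤ 1 / 2) :
    potential (x + θ) ≤
      potential x * (1 + ⟪(√(1 + ‖x‖ ^ 2))⁻¹ • x, θ⟫ + 33 / 16 * ‖θ‖ ^ 2) := by
  have hN := one_le_sqrt_one_add_sq x
  have h1 := sqrt_one_add_norm_add_sq_le x θ
  unfold potential
  have hN2 : √(1 + ‖x‖ ^ 2) ^ 2 = 1 + ‖x‖ ^ 2 := Real.sq_sqrt (by positivity)
  have hxN := norm_le_sqrt_one_add_sq x
  set N := √(1 + ‖x‖ ^ 2)
  have hin : |⟪N⁻¹ • x, θ⟫| ≤ ‖θ‖ := by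
    refine (abs_real_inner_le_norm _ _).trans ?_
    rw [norm_smul, Real.norm_of_nonneg (by positivity)]
    refine mul_le_of_le_one_left (norm_nonneg _) ?_
    rw [inv_mul_le_iff₀ (by linarith)]
    linarith
  set a := ⟪N⁻¹ • x, θ⟫
  obtain ⟨ha, ha'⟩ := abs_le.1 hin
  have h0 := norm_nonneg θ
  set y := a + ‖θ‖ ^ 2 / 2 with hy
  have hy1 : |y| ≤ 5 / 4 * ‖θ‖ := abs_le.2 ⟨by nlinarith, by nlinarith⟩
  have hexp := Real.abs_exp_sub_one_sub_id_le (x := y) (hy1.trans (by linarith))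
  have hy2 : y ^ 2 ≤ (5 / 4 * ‖θ‖) ^ 2 := sq_le_sq' (by linarith [(abs_le.1 hy1).1])
    (abs_le.1 hy1).2
  calc Real.exp √(1 + ‖x + θ‖ ^ 2) ≤ Real.exp (N + y) := Real.exp_le_exp.2 h1
    _ = Real.exp N * Real.exp y := Real.exp_add _ _
    _ ≤ _ := by
      gcongr
      nlinarith [(abs_le.1 hexp).2]

omit [InnerProductSpace ℝ E] in
lemma continuous_potential : Continuous (potential : E → ℝ) := by
  unfold potential
  fun_prop

variable [CompleteSpace E] [MeasurableSpace E] [BorelSpace E] [SecondCountableTopology E]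

/-- One step of the exponential moment bound: a small random perturbation with small mean and small
second moment increases the potential by a small factor only. -/
lemma lintegral_potential_add_le {Z : Type*} [MeasurableSpace Z] {ν : Measure Z}
    [IsProbabilityMeasure ν] {θ : Z → E} (hθm : Measurable θ) (hθ : ∀ z, ‖θ z‖ ≤ 1 / 2)
    {b : ℝ} (hb : ‖∫ z, θ z ∂ν‖ + 33 / 16 * ∫ z, ‖θ z‖ ^ 2 ∂ν ≤ b) (x : E) :
    ∫⁻ z, ENNReal.ofReal (potential (x + θ z)) ∂ν ≤
      ENNReal.ofReal (Real.exp b) * ENNReal.ofReal (potential x) := by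
  have hint : Integrable θ ν := integrable_of_norm_le hθm.aestronglyMeasurable hθ
  have hint2 : Integrable (fun z => ‖θ z‖ ^ 2) ν := by
    refine integrable_of_norm_le (K := 1 / 4) (by fun_prop) fun z => ?_
    rw [Real.norm_of_nonneg (by positivity)]
    nlinarith [hθ z, norm_nonneg (θ z)]
  set w := (√(1 + ‖x‖ ^ 2))⁻¹ • x with hw
  have hw1 : ‖w‖ ≤ 1 := by
    have hN := one_le_sqrt_one_add_sq x
    rw [hw, norm_smul, Real.norm_of_nonneg (by positivity), inv_mul_le_iff₀ (by linarith), mul_one]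
    exact norm_le_sqrt_one_add_sq x
  have hinti : Integrable (fun z => ⟪w, θ z⟫) ν := hint.const_inner w
  have hI1 : Integrable (fun z => (1 : ℝ) + ⟪w, θ z⟫) ν := (integrable_const _).add hinti
  have hI2 : Integrable (fun z => 33 / 16 * ‖θ z‖ ^ 2) ν := hint2.const_mul _
  have hpos : ∀ y : E, 0 < potential y := fun y => Real.exp_pos _
  calc ∫⁻ z, ENNReal.ofReal (potential (x + θ z)) ∂ν
      ≤ ∫⁻ z, ENNReal.ofReal (potential x * (1 + ⟪w, θ z⟫ + 33 / 16 * ‖θ z‖ ^ 2)) ∂ν :=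
        lintegral_mono fun z => ENNReal.ofReal_le_ofReal (potential_add_le (hθ z))
    _ = ENNReal.ofReal (∫ z, potential x * (1 + ⟪w, θ z⟫ + 33 / 16 * ‖θ z‖ ^ 2) ∂ν) := by
        refine (ofReal_integral_eq_lintegral_ofReal ((hI1.add hI2).const_mul _) ?_).symm
        exact .of_forall fun z => (hpos _).le.trans (potential_add_le (hθ z))
    _ ≤ ENNReal.ofReal (Real.exp b * potential x) := by
        refine ENNReal.ofReal_le_ofReal ?_
        rw [integral_const_mul, integral_add hI1 hI2, integral_add (integrable_const _) hinti,
          integral_const_mul, integral_inner hint]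
        have h1 : ⟪w, ∫ z, θ z ∂ν⟫ ≤ ‖∫ z, θ z ∂ν‖ :=
          (real_inner_le_norm _ _).trans (mul_le_of_le_one_left (norm_nonneg _) hw1)
        have h2 := Real.add_one_le_exp b
        rw [mul_comm]
        refine mul_le_mul_of_nonneg_right ?_ (hpos x).le
        simp only [integral_const, probReal_univ, smul_eq_mul, one_mul]
        linarith
    _ = _ := ENNReal.ofReal_mul (Real.exp_pos _).le

end Potential

/-! ### Consequences of Lipschitz gradients and Hessians. -/

section Smoothness

variable {d : ℕ} {F : EuclideanSpace ℝ (Fin d) → ℝ} {L : ℝ}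

/-- The quadratic upper bound for a function with Lipschitz gradient. -/
lemma GradientLipschitz.le_quadratic (hF : GradientLipschitz F L) (x v : EuclideanSpace ℝ (Fin d)) :
    F (x + v) ≤ F x + ⟪gradient F x, v⟫ + L / 2 * ‖v‖ ^ 2 := by
  let φ : ℝ → ℝ := fun t => F (x + t • v) - t * ⟪gradient F x, v⟫ - L / 2 * t ^ 2 * ‖v‖ ^ 2
  have hφ : ∀ t, HasDerivAt φ
      (⟪gradient F (x + t • v), v⟫ - ⟪gradient F x, v⟫ - L * t * ‖v‖ ^ 2) t := by
    intro t
    have h1 : HasDerivAt (fun t : ℝ => x + t • v) v t := by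
      simpa using ((hasDerivAt_id t).smul_const v).const_add x
    have h2 : HasDerivAt (fun t : ℝ => F (x + t • v)) ⟪gradient F (x + t • v), v⟫ t := by
      exact (hF.1 (x + t • v)).hasGradientAt.hasFDerivAt.comp_hasDerivAt t h1
    have h3 := (h2.sub ((hasDerivAt_id t).mul_const ⟪gradient F x, v⟫)).sub
      (((hasDerivAt_pow 2 t).const_mul (L / 2)).mul_const (‖v‖ ^ 2))
    refine h3.congr_deriv ?_
    simp only [one_mul, Nat.cast_ofNat, Nat.add_one_sub_one, pow_one]
    ring
  have hanti : AntitoneOn φ (Set.Icc 0 1) := by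
    refine antitoneOn_of_deriv_nonpos (convex_Icc 0 1)
      (fun t _ => (hφ t).continuousAt.continuousWithinAt)
      (fun t _ => (hφ t).differentiableAt.differentiableWithinAt) fun t ht => ?_
    rw [interior_Icc] at ht
    rw [(hφ t).deriv, ← inner_sub_left]
    have h1 := real_inner_le_norm (gradient F (x + t • v) - gradient F x) v
    have h2 := hF.2 (x + t • v) x
    rw [add_sub_cancel_left, norm_smul, Real.norm_of_nonneg ht.1.le] at h2
    nlinarith [norm_nonneg v]
  have h := hanti (Set.left_mem_Icc.2 zero_le_one) (Set.right_mem_Icc.2 zero_le_one) zero_le_one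
  simp only [φ, zero_smul, one_smul, add_zero] at h
  linarith

lemma GradientLipschitz.norm_gradient_sq_le (hF : GradientLipschitz F L) (hL : 0 ≤ L)
    (hb : BddBelow (Set.range F)) (x : EuclideanSpace ℝ (Fin d)) :
    ‖gradient F x‖ ^ 2 ≤ 2 * L * (F x - ⨅ y, F y) := by
  have hx : 0 ≤ F x - ⨅ y, F y := sub_nonneg.2 (ciInf_le hb x)
  set δ := F x - ⨅ y, F y with hδ
  -- A gradient step of length `1 / L'` cannot go below the infimum. Since `L` may vanish, the step
  -- uses `L' > L` and the bound for `L` follows in the limit.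
  have key : ∀ L' : ℝ, L < L' → ‖gradient F x‖ ^ 2 ≤ 2 * L' * δ := by
    intro L' hL'
    have hp : 0 < L' := hL.trans_lt hL'
    have h1 := hF.le_quadratic x (-(L'⁻¹ • gradient F x))
    have h2 := ciInf_le hb (x + -(L'⁻¹ • gradient F x))
    rw [inner_neg_right, inner_smul_right, real_inner_self_eq_norm_sq, norm_neg, norm_smul,
      Real.norm_of_nonneg (by positivity), mul_pow] at h1
    have h3 : L / 2 * (L'⁻¹ ^ 2 * ‖gradient F x‖ ^ 2) ≤
        L' / 2 * (L'⁻¹ ^ 2 * ‖gradient F x‖ ^ 2) := by gcongr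
    have h4 : L' / 2 * (L'⁻¹ ^ 2 * ‖gradient F x‖ ^ 2) = L'⁻¹ * ‖gradient F x‖ ^ 2 / 2 := by
      field_simp
    have h5 : L'⁻¹ * ‖gradient F x‖ ^ 2 ≤ 2 * δ := by linarith
    rw [inv_mul_le_iff₀ hp] at h5
    linarith
  have hc : Filter.Tendsto (fun L' : ℝ => 2 * L' * δ) (nhdsWithin L (Set.Ioi L))
      (nhds (2 * L * δ)) :=
    ((continuous_const.mul continuous_id).mul continuous_const).continuousAt.continuousWithinAt
  exact ge_of_tendsto hc (eventually_nhdsWithin_of_forall key)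

lemma GradientLipschitz.norm_hessian_le (hF : GradientLipschitz F L) (hL : 0 ≤ L)
    (x : EuclideanSpace ℝ (Fin d)) : ‖hessian F x‖ ≤ L := by
  have : LipschitzWith ⟨L, hL⟩ (gradient F) :=
    LipschitzWith.of_dist_le_mul fun x y => by rw [dist_eq_norm, dist_eq_norm]; exact hF.2 x y
  exact norm_fderiv_le_of_lipschitz ℝ this

lemma HessianLipschitz.contDiff_gradient (hF : HessianLipschitz F L) :
    ContDiff ℝ 1 (gradient F) := by
  have h := hF.1.fderiv_right (m := 1) (by norm_num)
  exact (InnerProductSpace.toDual ℝ (EuclideanSpace ℝ (Fin d))).symm.toContinuousLinearEquiv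
    |>.contDiff.comp h

lemma HessianLipschitz.continuous_gradient (hF : HessianLipschitz F L) :
    Continuous (gradient F) := hF.contDiff_gradient.continuous

lemma HessianLipschitz.continuous_hessian (hF : HessianLipschitz F L) :
    Continuous (hessian F) := hF.contDiff_gradient.continuous_fderiv (by norm_num)

/-- Taylor's formula for the gradient, with the Hessian taken anywhere on the segment. -/
lemma HessianLipschitz.norm_gradient_sub_le (hF : HessianLipschitz F L) (hL : 0 ≤ L)
    (x y : EuclideanSpace ℝ (Fin d)) {u : ℝ} (hu : u ∈ Set.Icc (0 : ℝ) 1) :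
    ‖gradient F y - gradient F x - hessian F (u • y + (1 - u) • x) (y - x)‖ ≤
      L * ‖y - x‖ ^ 2 := by
  have hz : u • y + (1 - u) • x ∈ segment ℝ x y :=
    ⟨1 - u, u, by linarith [hu.2], hu.1, by ring, by abel⟩
  -- Mean value inequality for the gradient minus the linear map frozen at one point of the segment:
  -- any two points of the segment are at most `‖y - x‖` apart.
  have := (convex_segment x y).norm_image_sub_le_of_norm_hasFDerivWithin_le'
    (f := gradient F) (f' := hessian F) (φ := hessian F (u • y + (1 - u) • x)) (C := L * ‖y - x‖)
    (fun z _ => (hF.contDiff_gradient.differentiable (by norm_num) z).hasFDerivAt.hasFDerivWithinAt)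
    (fun z hz' => (hF.2 z _).trans ?_) (left_mem_segment ℝ x y) (right_mem_segment ℝ x y)
  · refine this.trans (le_of_eq (by ring))
  · gcongr
    obtain ⟨a, b, ha, hb, hab, rfl⟩ := hz'
    obtain rfl : a = 1 - b := by linarith
    have : (1 - b) • x + b • y - (u • y + (1 - u) • x) = (b - u) • (y - x) := by module
    rw [this, norm_smul]
    refine mul_le_of_le_one_left (norm_nonneg _) ?_
    rw [Real.norm_eq_abs, abs_le]
    exact ⟨by linarith [hu.2], by linarith [hu.1]⟩

end Smoothness

/-! ### Descent of one normalized step. -/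

section Descent

variable {d : ℕ} {F : EuclideanSpace ℝ (Fin d) → ℝ} {L : ℝ}

lemma norm_normalizedStep_sub_le {γ : ℝ} (hγ : 0 ≤ γ) (x g : EuclideanSpace ℝ (Fin d)) :
    ‖normalizedStep γ x g - x‖ ≤ γ := by
  have : normalizedStep γ x g - x = -(γ • (‖g‖⁻¹ • g)) := by rw [normalizedStep]; abel
  rw [this, norm_neg, norm_smul, norm_smul, norm_inv, norm_norm, Real.norm_of_nonneg hγ]
  exact mul_le_of_le_one_right hγ (inv_mul_le_one)

/-- With `m` the gradient, the inner product of `m` with `g / ‖g‖` is at least `‖g‖ - ‖g - m‖`,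
hence at least `‖m‖ - 2‖g - m‖`. The convention for `g = 0` is harmless. -/
lemma GradientLipschitz.normalizedStep_le (hF : GradientLipschitz F L) (hL : 0 ≤ L) {γ : ℝ}
    (hγ : 0 ≤ γ) (x g : EuclideanSpace ℝ (Fin d)) :
    F (normalizedStep γ x g) ≤
      F x - γ * ‖gradient F x‖ + 2 * γ * ‖g - gradient F x‖ + L / 2 * γ ^ 2 := by
  have h1 := hF.le_quadratic x (-(γ • (‖g‖⁻¹ • g)))
  have h2 := norm_normalizedStep_sub_le hγ x g
  have h3 : normalizedStep γ x g - x = -(γ • (‖g‖⁻¹ • g)) := by rw [normalizedStep]; abel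
  rw [h3] at h2
  have h4 : L / 2 * ‖-(γ • (‖g‖⁻¹ • g))‖ ^ 2 ≤ L / 2 * γ ^ 2 := by gcongr
  have h5 : ⟪gradient F x, -(γ • (‖g‖⁻¹ • g))⟫ ≤
      γ * (2 * ‖g - gradient F x‖ - ‖gradient F x‖) := by
    rw [inner_neg_right, inner_smul_right, ← mul_neg]
    refine mul_le_mul_of_nonneg_left ?_ hγ
    set m := gradient F x
    have h6 : ⟪m, ‖g‖⁻¹ • g⟫ = ‖g‖ - ⟪g - m, ‖g‖⁻¹ • g⟫ := by
      rw [inner_sub_left, inner_smul_right g, real_inner_self_eq_norm_sq]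
      rcases eq_or_ne ‖g‖ 0 with h | h
      · simp [h]
      · field_simp
        ring
    have h7 : ⟪g - m, ‖g‖⁻¹ • g⟫ ≤ ‖g - m‖ := by
      refine (real_inner_le_norm _ _).trans (mul_le_of_le_one_right (norm_nonneg _) ?_)
      rw [norm_smul, norm_inv, norm_norm]
      exact inv_mul_le_one
    have h8 : ‖m‖ ≤ ‖g‖ + ‖g - m‖ := by
      have := norm_sub_le g (g - m)
      simpa using this
    linarith
  have h9 : normalizedStep γ x g = x + -(γ • (‖g‖⁻¹ • g)) := by rw [normalizedStep]; abel
  rw [h9]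
  linarith

end Descent

/-! ### Independence in recursions driven by independent samples. -/

section Recursion

variable {Ω S Z : Type*} [MeasurableSpace Ω] [MeasurableSpace S] [MeasurableSpace Z]
  {P : Measure Ω} {ζ : ℕ → Ω → Z} {Y : ℕ → Ω → S} {Ψ : S × Z → S}

omit [MeasurableSpace Ω] in
lemma measurable_iSup_comap_of_recursion (hΨ : Measurable Ψ) {s : S} (h0 : ∀ ω, Y 0 ω = s)
    (hs : ∀ t ω, Y (t + 1) ω = Ψ (Y t ω, ζ (t + 1) ω)) (t : ℕ) :
    Measurable[⨆ i ∈ Set.Iic t, MeasurableSpace.comap (ζ i) inferInstance] (Y t) := by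
  induction t with
  | zero => rw [show Y 0 = fun _ => s from funext h0]; exact measurable_const
  | succ t ih =>
    rw [show Y (t + 1) = fun ω => Ψ (Y t ω, ζ (t + 1) ω) from funext (hs t)]
    refine hΨ.comp (Measurable.prodMk (ih.mono ?_ le_rfl) ?_)
    · exact biSup_mono fun i (hi : i ≤ t) => show i ≤ t + 1 by omega
    · exact (comap_measurable (ζ (t + 1))).mono
        (le_biSup (fun i => MeasurableSpace.comap (ζ i) inferInstance)
          (Set.mem_Iic.2 (le_refl (t + 1)))) le_rfl

lemma measurable_of_recursion (hΨ : Measurable Ψ) {s : S} (h0 : ∀ ω, Y 0 ω = s)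
    (hs : ∀ t ω, Y (t + 1) ω = Ψ (Y t ω, ζ (t + 1) ω)) (hζ : ∀ t, Measurable (ζ t)) (t : ℕ) :
    Measurable (Y t) :=
  (measurable_iSup_comap_of_recursion hΨ h0 hs t).mono
    (iSup₂_le fun i _ => (hζ i).comap_le) le_rfl

/-- In a recursion driven by independent samples, the state is independent of the next sample. -/
lemma indepFun_of_recursion (hΨ : Measurable Ψ) {s : S} (h0 : ∀ ω, Y 0 ω = s)
    (hs : ∀ t ω, Y (t + 1) ω = Ψ (Y t ω, ζ (t + 1) ω)) (hζ : ∀ t, Measurable (ζ t))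
    (hind : iIndepFun ζ P) (t : ℕ) : IndepFun (Y t) (ζ (t + 1)) P := by
  have hdisj : Disjoint (Set.Iic t) {t + 1} := by simp
  have h := indep_iSup_of_disjoint (fun i => (hζ i).comap_le) hind.iIndep hdisj
  rw [IndepFun_iff_Indep]
  refine indep_of_indep_of_le_left (indep_of_indep_of_le_right h ?_)
    (measurable_iSup_comap_of_recursion hΨ h0 hs t).comap_le
  simp

/-- This replaces conditional expectation: by independence the next sample can be integrated out
with the state held fixed. -/
lemma lintegral_of_recursion [IsProbabilityMeasure P] (hΨ : Measurable Ψ) {s : S}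
    (h0 : ∀ ω, Y 0 ω = s) (hs : ∀ t ω, Y (t + 1) ω = Ψ (Y t ω, ζ (t + 1) ω))
    (hζ : ∀ t, Measurable (ζ t)) (hind : iIndepFun ζ P) {ν : Measure Z} [IsProbabilityMeasure ν]
    (hν : ∀ t, P.map (ζ t) = ν) {f : S × Z → ℝ≥0∞} (hf : Measurable f) (t : ℕ) :
    ∫⁻ ω, f (Y t ω, ζ (t + 1) ω) ∂P = ∫⁻ ω, ∫⁻ z, f (Y t ω, z) ∂ν ∂P := by
  have hY := measurable_of_recursion hΨ h0 hs hζ t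
  have hi := (indepFun_iff_map_prod_eq_prod_map_map hY.aemeasurable
    (hζ (t + 1)).aemeasurable).1 (indepFun_of_recursion hΨ h0 hs hζ hind t)
  calc ∫⁻ ω, f (Y t ω, ζ (t + 1) ω) ∂P
      = ∫⁻ y, f y ∂(P.map fun ω => (Y t ω, ζ (t + 1) ω)) :=
        (lintegral_map hf (hY.prodMk (hζ _))).symm
    _ = ∫⁻ y, ∫⁻ z, f (y, z) ∂ν ∂(P.map (Y t)) := by
        rw [hi, hν, lintegral_prod _ hf.aemeasurable]
    _ = _ := lintegral_map hf.lintegral_prod_right' hY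

end Recursion

/-! ### Exponential moments and tails of the weighted noise sum. -/

section ExponentialMoment

variable {Ω S Z E : Type*} [MeasurableSpace Ω] [MeasurableSpace S] [MeasurableSpace Z]
  [NormedAddCommGroup E] [InnerProductSpace ℝ E] [MeasurableSpace E] [BorelSpace E]
  [SecondCountableTopology E] {P : Measure Ω} [IsProbabilityMeasure P] {ζ : ℕ → Ω → Z}
  {Y : ℕ → Ω → S × E} {Ψ : S × Z → S} {θ : S × Z → E} {α : ℝ}

/-- Exponential moments of an exponentially weighted sum of the noise `θ`. -/
lemma lintegral_potential_le_of_recursion (hΨ : Measurable Ψ) (hθ : Measurable θ) {s : S}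
    (h0 : ∀ ω, Y 0 ω = (s, 0))
    (hs : ∀ t ω, Y (t + 1) ω = (Ψ ((Y t ω).1, ζ (t + 1) ω),
      (1 - α) • (Y t ω).2 + θ ((Y t ω).1, ζ (t + 1) ω)))
    (hζ : ∀ t, Measurable (ζ t)) (hind : iIndepFun ζ P) {ν : Measure Z} [IsProbabilityMeasure ν]
    (hν : ∀ t, P.map (ζ t) = ν) (hα0 : 0 ≤ α) (hα1 : α ≤ 1) {R K : ℝ} (hR : 0 ≤ R)
    (hstep : ∀ t ω lam, 0 ≤ lam → lam * R ≤ 1 / 3 → ∀ y,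
      ∫⁻ z, ENNReal.ofReal (potential (y + lam • θ ((Y t ω).1, z))) ∂ν ≤
        ENNReal.ofReal (Real.exp (K * α * (lam * R))) * ENNReal.ofReal (potential y))
    (t : ℕ) {lam : ℝ} (hl : 0 ≤ lam) (hlR : lam * R ≤ 1 / 3) (hK : 0 ≤ K) :
    ∫⁻ ω, ENNReal.ofReal (potential (lam • (Y t ω).2)) ∂P ≤
      ENNReal.ofReal (Real.exp (1 + K * (lam * R))) := by
  -- The step from `t` to `t + 1` at `lam` uses the bound at the smaller scale `lam * (1 - α)`.
  induction t generalizing lam with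
  | zero =>
    simp only [h0, smul_zero, potential, norm_zero, ne_eq, OfNat.ofNat_ne_zero, not_false_eq_true,
      zero_pow, add_zero, Real.sqrt_one, lintegral_const, measure_univ, mul_one]
    gcongr
    nlinarith [mul_nonneg hK (mul_nonneg hl hR)]
  | succ t ih =>
    have hmeas : Measurable fun y : (S × E) × Z =>
        ENNReal.ofReal (potential (lam • ((1 - α) • y.1.2 + θ (y.1.1, y.2)))) := by
      have := (continuous_potential (E := E)).measurable
      fun_prop
    have hΨ' : Measurable fun y : (S × E) × Z =>
        (Ψ (y.1.1, y.2), (1 - α) • y.1.2 + θ (y.1.1, y.2)) := by fun_prop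
    have h := lintegral_of_recursion hΨ' h0 hs hζ hind hν hmeas t
    have hle : (lam * (1 - α)) * R ≤ lam * R := by nlinarith [mul_nonneg hl hR]
    have ih' := ih (mul_nonneg hl (sub_nonneg.2 hα1)) (hle.trans hlR)
    simp only [hs]
    rw [h]
    calc ∫⁻ ω, ∫⁻ z, ENNReal.ofReal
          (potential (lam • ((1 - α) • (Y t ω).2 + θ ((Y t ω).1, z)))) ∂ν ∂P
        ≤ ∫⁻ ω, ENNReal.ofReal (Real.exp (K * α * (lam * R))) *
            ENNReal.ofReal (potential ((lam * (1 - α)) • (Y t ω).2)) ∂P := by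
          refine lintegral_mono fun ω => ?_
          simp only [smul_add, smul_smul]
          exact hstep t ω lam hl hlR _
      _ = ENNReal.ofReal (Real.exp (K * α * (lam * R))) *
            ∫⁻ ω, ENNReal.ofReal (potential ((lam * (1 - α)) • (Y t ω).2)) ∂P :=
          lintegral_const_mul' _ _ ENNReal.ofReal_ne_top
      _ ≤ ENNReal.ofReal (Real.exp (K * α * (lam * R))) *
            ENNReal.ofReal (Real.exp (1 + K * (lam * (1 - α) * R))) := by gcongr
      -- The exponent is stationary: `Kα lam R + K(1 - α) lam R = K lam R`, so nothing accumulates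
      -- with `t`.
      _ = ENNReal.ofReal (Real.exp (1 + K * (lam * R))) := by
          rw [← ENNReal.ofReal_mul (Real.exp_pos _).le, ← Real.exp_add]
          ring_nf

omit [SecondCountableTopology E] [IsProbabilityMeasure P] in
/-- The tail bound that follows from an exponential moment. -/
lemma measure_le_norm_of_lintegral_potential {X : Ω → E} (hX : Measurable X) {lam B : ℝ}
    (hl : 0 ≤ lam) (h : ∫⁻ ω, ENNReal.ofReal (potential (lam • X ω)) ∂P ≤
      ENNReal.ofReal (Real.exp B)) (a : ℝ) :
    P {ω | a ≤ lam * ‖X ω‖} ≤ ENNReal.ofReal (Real.exp (B - a)) := by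
  have hm : Measurable fun ω => ENNReal.ofReal (potential (lam • X ω)) := by
    have := (continuous_potential (E := E)).measurable
    fun_prop
  have h1 := (mul_meas_ge_le_lintegral (μ := P) hm (ENNReal.ofReal (Real.exp a))).trans h
  have h2 : P {ω | a ≤ lam * ‖X ω‖} ≤
      P {ω | ENNReal.ofReal (Real.exp a) ≤ ENNReal.ofReal (potential (lam • X ω))} := by
    refine measure_mono fun ω hω => ENNReal.ofReal_le_ofReal (Real.exp_le_exp.2 ?_)
    have := norm_le_sqrt_one_add_sq (lam • X ω)
    rw [norm_smul, Real.norm_of_nonneg hl] at this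
    rw [norm_smul, Real.norm_of_nonneg hl]
    exact le_trans hω this
  rw [Real.exp_sub, ENNReal.ofReal_div_of_pos (Real.exp_pos _)]
  rw [ENNReal.le_div_iff_mul_le (.inl (by simp [Real.exp_pos])) (.inl ENNReal.ofReal_ne_top),
    mul_comm]
  exact le_trans (by gcongr) h1

end ExponentialMoment

/-! ### The noise of one step. -/

section Noise

variable {d : ℕ} {Ξ : Type*} [MeasurableSpace Ξ]

/-- The noise of one step of the algorithm from the state `s`: the error of the clipped Hessian
estimator, plus the error of the clipped gradient estimator as long as the true gradient is well
below the clipping level. -/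
def noise (F : EuclideanSpace ℝ (Fin d) → ℝ)
    (G : EuclideanSpace ℝ (Fin d) → Ξ → EuclideanSpace ℝ (Fin d))
    (H : EuclideanSpace ℝ (Fin d) → Ξ →
      (EuclideanSpace ℝ (Fin d) →L[ℝ] EuclideanSpace ℝ (Fin d)))
    (α lam₁ lam₂ : ℝ)
    (s : (EuclideanSpace ℝ (Fin d) × EuclideanSpace ℝ (Fin d) × EuclideanSpace ℝ (Fin d)) ×
      (ℝ × Ξ × Ξ)) : EuclideanSpace ℝ (Fin d) :=
  (1 - α) • (clip (H (s.2.1 • s.1.2.1 + (1 - s.2.1) • s.1.1) s.2.2.2 (s.1.2.1 - s.1.1)) lam₁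
      - hessian F (s.2.1 • s.1.2.1 + (1 - s.2.1) • s.1.1) (s.1.2.1 - s.1.1))
    + α • (if ‖gradient F s.1.2.1‖ ≤ lam₂ / 2 then
        clip (G s.1.2.1 s.2.2.1) lam₂ - gradient F s.1.2.1 else 0)

variable {F : EuclideanSpace ℝ (Fin d) → ℝ}
    {G : EuclideanSpace ℝ (Fin d) → Ξ → EuclideanSpace ℝ (Fin d)}
    {H : EuclideanSpace ℝ (Fin d) → Ξ →
      (EuclideanSpace ℝ (Fin d) →L[ℝ] EuclideanSpace ℝ (Fin d))}
    {α lam₁ lam₂ p q σ₁ σ₂ L₁ L₂ γ : ℝ} {D : Measure Ξ} [IsProbabilityMeasure D]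

lemma measurable_apply_oracle (hH : Measurable (Function.uncurry H)) {A : Type*}
    [MeasurableSpace A] {x v : A → EuclideanSpace ℝ (Fin d)} {ξ : A → Ξ} (hx : Measurable x)
    (hξ : Measurable ξ) (hv : Measurable v) : Measurable fun a => H (x a) (ξ a) (v a) := by
  have h1 : Measurable fun a => H (x a) (ξ a) := hH.comp (hx.prodMk hξ)
  have h2 : Continuous fun y : (EuclideanSpace ℝ (Fin d) →L[ℝ] EuclideanSpace ℝ (Fin d)) ×
    EuclideanSpace ℝ (Fin d) => y.1 y.2 := by fun_prop
  exact h2.measurable.comp (h1.prodMk hv)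

lemma measurable_noise (hF : HessianLipschitz F L₂) (hG : Measurable (Function.uncurry G))
    (hH : Measurable (Function.uncurry H)) : Measurable (noise F G H α lam₁ lam₂) := by
  have hg := hF.continuous_gradient.measurable
  have hh : Measurable (Function.uncurry fun x (_ : Unit) => hessian F x) :=
    hF.continuous_hessian.measurable.comp measurable_fst
  have hx : Measurable fun s : (EuclideanSpace ℝ (Fin d) × EuclideanSpace ℝ (Fin d) ×
      EuclideanSpace ℝ (Fin d)) × (ℝ × Ξ × Ξ) => s.2.1 • s.1.2.1 + (1 - s.2.1) • s.1.1 := by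
    fun_prop
  have hv : Measurable fun s : (EuclideanSpace ℝ (Fin d) × EuclideanSpace ℝ (Fin d) ×
      EuclideanSpace ℝ (Fin d)) × (ℝ × Ξ × Ξ) => s.1.2.1 - s.1.1 := by fun_prop
  have hgs : Measurable fun s : (EuclideanSpace ℝ (Fin d) × EuclideanSpace ℝ (Fin d) ×
      EuclideanSpace ℝ (Fin d)) × (ℝ × Ξ × Ξ) => gradient F s.1.2.1 := by fun_prop
  have hGs : Measurable fun s : (EuclideanSpace ℝ (Fin d) × EuclideanSpace ℝ (Fin d) ×
      EuclideanSpace ℝ (Fin d)) × (ℝ × Ξ × Ξ) => G s.1.2.1 s.2.2.1 :=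
    hG.comp (.prodMk (by fun_prop) (by fun_prop))
  have hH1 := (measurable_clip lam₁).comp (measurable_apply_oracle hH hx
    (measurable_snd.comp (measurable_snd.comp measurable_snd)) hv)
  have hH2 := measurable_apply_oracle hh hx (measurable_const (a := ())) hv
  exact ((hH1.sub hH2).const_smul (1 - α)).add ((Measurable.ite
    (measurableSet_le hgs.norm measurable_const)
    (((measurable_clip lam₂).comp hGs).sub hgs) measurable_const).const_smul α)

/-- A random vector that is bounded by `3 / 2 * lam`, with mean at most `2 * α * lam` and second
moment at most `4 * α * lam ^ 2`. -/
structure SmallNoise {Z : Type*} [MeasurableSpace Z] (ν : Measure Z)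
    (X : Z → EuclideanSpace ℝ (Fin d)) (α lam : ℝ) : Prop where
  measurable : Measurable X
  norm_le : ∀ z, ‖X z‖ ≤ 3 / 2 * lam
  norm_integral_le : ‖∫ z, X z ∂ν‖ ≤ 2 * α * lam
  integral_sq_le : ∫ z, ‖X z‖ ^ 2 ∂ν ≤ 4 * α * lam ^ 2

lemma smallNoise_grad (hG : GradientBCM D F G p σ₁) (hp : 1 ≤ p) (hp2 : p ≤ 2) (hl : 0 < lam₂)
    (hα : 0 ≤ α) (hσ : σ₁ ^ p ≤ α * lam₂ ^ p) (x : EuclideanSpace ℝ (Fin d)) :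
    SmallNoise D (fun ξ => if ‖gradient F x‖ ≤ lam₂ / 2 then
        clip (G x ξ) lam₂ - gradient F x else 0) α lam₂ := by
  by_cases h : ‖gradient F x‖ ≤ lam₂ / 2
  · simp only [h, if_true]
    have hm := (hG.moment_le x).trans hσ
    exact ⟨((measurable_clip _).comp hG.measurable.of_uncurry_left).sub_const _,
      fun z => norm_clip_sub_le hl.le h,
      norm_integral_clip_sub_le hl h hp hp2 (hG.integrable x) (hG.unbiased x)
        (hG.integrable_moment x) (fun _ => le_rfl) hm,
      integral_norm_clip_sub_sq_le hl h hp hp2 (hG.integrable_moment x) (fun _ => le_rfl) hm⟩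
  · simp only [h, if_false]
    exact ⟨measurable_const, fun _ => by simp; positivity, by simp; positivity,
      by simp; positivity⟩

/-- The displacement has length at most `γ`, so the Hessian-vector product has mean at most `γ L₁ ≤
lam₁ / 2` in norm and moment scale `γ σ₂`. The evaluation point is fixed, so this applies for each
value of `u_t`. -/
lemma smallNoise_hess (hH : HessianBCM D F H q σ₂) (hF : GradientLipschitz F L₁) (hL : 0 ≤ L₁)
    (hq : 1 ≤ q) (hq2 : q ≤ 2) (hl : 0 < lam₁)
    (hσ : (γ * σ₂) ^ q ≤ α * lam₁ ^ q) (hσ0 : 0 ≤ σ₂) (hLl : 2 * γ * L₁ ≤ lam₁)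
    (x v : EuclideanSpace ℝ (Fin d)) (hv : ‖v‖ ≤ γ) :
    SmallNoise D (fun ξ => clip (H x ξ v) lam₁ - hessian F x v) α lam₁ := by
  have hγ : 0 ≤ γ := (norm_nonneg v).trans hv
  have hm : ‖hessian F x v‖ ≤ lam₁ / 2 := by
    calc ‖hessian F x v‖ ≤ ‖hessian F x‖ * ‖v‖ := ContinuousLinearMap.le_opNorm _ _
      _ ≤ L₁ * γ := by gcongr; exact hF.norm_hessian_le hL x
      _ ≤ _ := by linarith
  have hg : Integrable (fun ξ => γ ^ q * ‖H x ξ - hessian F x‖ ^ q) D :=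
    (hH.integrable_moment x).const_mul _
  have hXg : ∀ ξ, ‖H x ξ v - hessian F x v‖ ^ q ≤ γ ^ q * ‖H x ξ - hessian F x‖ ^ q := by
    intro ξ
    rw [← Real.mul_rpow hγ (norm_nonneg _), ← sub_apply, mul_comm]
    gcongr
    exact (ContinuousLinearMap.le_opNorm _ _).trans (by gcongr)
  have hgα : ∫ ξ, γ ^ q * ‖H x ξ - hessian F x‖ ^ q ∂D ≤ α * lam₁ ^ q := by
    rw [integral_const_mul]
    refine le_trans ?_ hσ
    rw [Real.mul_rpow hγ hσ0]
    gcongr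
    exact hH.moment_le x
  have hint : Integrable (fun ξ => H x ξ v) D :=
    (ContinuousLinearMap.apply ℝ _ v).integrable_comp (hH.integrable x)
  have hXm : ∫ ξ, H x ξ v ∂D = hessian F x v := by
    rw [← hH.unbiased x, ContinuousLinearMap.integral_apply (hH.integrable x)]
  exact ⟨((measurable_clip _).comp (measurable_apply_oracle hH.measurable measurable_const
      measurable_id measurable_const)).sub_const _,
    fun z => norm_clip_sub_le hl.le hm,
    norm_integral_clip_sub_le hl hm hq hq2 hint hXm hg hXg hgα,
    integral_norm_clip_sub_sq_le hl hm hq hq2 hg hXg hgα⟩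

/-- The condition `lam * R ≤ 1 / 3` makes the scaled noise at most `3/2 · 1/3 = 1/2`. The exponent
collects `2` from the mean and `33/16 · 8 · 1/3 = 5.5` from the second moment, both times `α lam R`,
which is below `8`. -/
lemma SmallNoise.lintegral_potential_le {A B : Ξ → EuclideanSpace ℝ (Fin d)}
    (hA : SmallNoise D A α lam₁) (hB : SmallNoise D B α lam₂) (hα0 : 0 ≤ α) (hα1 : α ≤ 1)
    (hl₁ : 0 ≤ lam₁) (hl₂ : 0 ≤ lam₂) {lam : ℝ} (hlam : 0 ≤ lam)
    (hlamR : lam * (lam₁ + α * lam₂) ≤ 1 / 3) (y : EuclideanSpace ℝ (Fin d)) :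
    ∫⁻ z, ENNReal.ofReal (potential (y + lam • ((1 - α) • A z.2 + α • B z.1))) ∂(D.prod D) ≤
      ENNReal.ofReal (Real.exp (8 * α * (lam * (lam₁ + α * lam₂)))) *
        ENNReal.ofReal (potential y) := by
  have hmA := hA.measurable
  have hmB := hB.measurable
  have hα' : 0 ≤ 1 - α := by linarith
  set R := lam₁ + α * lam₂ with hR
  have hR0 : 0 ≤ R := by positivity
  have hn : ∀ z : Ξ × Ξ, ‖(1 - α) • A z.2 + α • B z.1‖ ≤ 3 / 2 * R := by
    intro z
    calc ‖(1 - α) • A z.2 + α • B z.1‖ ≤ ‖(1 - α) • A z.2‖ + ‖α • B z.1‖ := norm_add_le _ _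
      _ = (1 - α) * ‖A z.2‖ + α * ‖B z.1‖ := by
        rw [norm_smul, norm_smul, Real.norm_of_nonneg hα', Real.norm_of_nonneg hα0]
      _ ≤ 1 * (3 / 2 * lam₁) + α * (3 / 2 * lam₂) := by
        gcongr
        · linarith
        · exact hA.norm_le _
        · exact hB.norm_le _
      _ = _ := by rw [hR]; ring
  have hiA : Integrable (fun z : Ξ × Ξ => A z.2) (D.prod D) :=
    integrable_of_norm_le (Measurable.aestronglyMeasurable (by fun_prop)) fun z => hA.norm_le _
  have hiB : Integrable (fun z : Ξ × Ξ => B z.1) (D.prod D) :=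
    integrable_of_norm_le (Measurable.aestronglyMeasurable (by fun_prop)) fun z => hB.norm_le _
  have hiA2 : Integrable (fun z : Ξ × Ξ => ‖A z.2‖ ^ 2) (D.prod D) :=
    integrable_of_norm_le (K := (3 / 2 * lam₁) ^ 2)
      (Measurable.aestronglyMeasurable (by fun_prop)) fun z => by
      rw [Real.norm_of_nonneg (by positivity)]; gcongr; exact hA.norm_le _
  have hiB2 : Integrable (fun z : Ξ × Ξ => ‖B z.1‖ ^ 2) (D.prod D) :=
    integrable_of_norm_le (K := (3 / 2 * lam₂) ^ 2)
      (Measurable.aestronglyMeasurable (by fun_prop)) fun z => by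
      rw [Real.norm_of_nonneg (by positivity)]; gcongr; exact hB.norm_le _
  have hmean : ‖∫ z : Ξ × Ξ, ((1 - α) • A z.2 + α • B z.1) ∂(D.prod D)‖ ≤ 2 * α * R := by
    have hsA : Integrable (fun z : Ξ × Ξ => (1 - α) • A z.2) (D.prod D) := hiA.smul (1 - α)
    have hsB : Integrable (fun z : Ξ × Ξ => α • B z.1) (D.prod D) := hiB.smul α
    rw [integral_add hsA hsB, integral_smul, integral_smul,
      integral_fun_snd A, integral_fun_fst B]
    simp only [probReal_univ, one_smul]
    calc ‖(1 - α) • ∫ z, A z ∂D + α • ∫ z, B z ∂D‖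
        ≤ ‖(1 - α) • ∫ z, A z ∂D‖ + ‖α • ∫ z, B z ∂D‖ := norm_add_le _ _
      _ = (1 - α) * ‖∫ z, A z ∂D‖ + α * ‖∫ z, B z ∂D‖ := by
        rw [norm_smul, norm_smul, Real.norm_of_nonneg hα', Real.norm_of_nonneg hα0]
      _ ≤ 1 * (2 * α * lam₁) + α * (2 * α * lam₂) := by
        gcongr
        · linarith
        · exact hA.norm_integral_le
        · exact hB.norm_integral_le
      _ = _ := by rw [hR]; ring
  have hsq : ∫ z : Ξ × Ξ, ‖(1 - α) • A z.2 + α • B z.1‖ ^ 2 ∂(D.prod D) ≤ 8 * α * R ^ 2 := by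
    calc ∫ z : Ξ × Ξ, ‖(1 - α) • A z.2 + α • B z.1‖ ^ 2 ∂(D.prod D)
        ≤ ∫ z : Ξ × Ξ, (2 * ‖A z.2‖ ^ 2 + 2 * α ^ 2 * ‖B z.1‖ ^ 2) ∂(D.prod D) := by
          refine integral_mono_of_nonneg (.of_forall fun z => by positivity)
            ((hiA2.const_mul _).add (hiB2.const_mul _)) (.of_forall fun z => ?_)
          have h1 : ‖(1 - α) • A z.2 + α • B z.1‖ ≤ ‖A z.2‖ + α * ‖B z.1‖ := by
            refine (norm_add_le _ _).trans ?_
            rw [norm_smul, norm_smul, Real.norm_of_nonneg hα', Real.norm_of_nonneg hα0]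
            gcongr
            exact mul_le_of_le_one_left (norm_nonneg _) (by linarith)
          calc ‖(1 - α) • A z.2 + α • B z.1‖ ^ 2 ≤ (‖A z.2‖ + α * ‖B z.1‖) ^ 2 := by gcongr
            _ ≤ 2 * (‖A z.2‖ ^ 2 + (α * ‖B z.1‖) ^ 2) := add_sq_le
            _ = _ := by ring
      _ = 2 * ∫ z, ‖A z‖ ^ 2 ∂D + 2 * α ^ 2 * ∫ z, ‖B z‖ ^ 2 ∂D := by
          rw [integral_add (hiA2.const_mul _) (hiB2.const_mul _), integral_const_mul,
            integral_const_mul, integral_fun_snd (fun z => ‖A z‖ ^ 2),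
            integral_fun_fst (fun z => ‖B z‖ ^ 2)]
          simp
      _ ≤ 2 * (4 * α * lam₁ ^ 2) + 2 * α ^ 2 * (4 * α * lam₂ ^ 2) := by
          gcongr
          · exact hA.integral_sq_le
          · exact hB.integral_sq_le
      _ ≤ 8 * α * R ^ 2 := by
          have : 0 ≤ α * (lam₁ * (α * lam₂)) := by positivity
          rw [hR]; linarith
  refine lintegral_potential_add_le (by fun_prop) (fun z => ?_) ?_ y
  · rw [norm_smul, Real.norm_of_nonneg hlam]
    nlinarith [mul_le_mul_of_nonneg_left (hn z) hlam]
  · rw [integral_smul, norm_smul, Real.norm_of_nonneg hlam]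
    simp only [norm_smul, Real.norm_of_nonneg hlam, mul_pow]
    rw [integral_const_mul]
    have h1 := mul_le_mul_of_nonneg_left hmean hlam
    have h2 := mul_le_mul_of_nonneg_left hsq (sq_nonneg lam)
    have h3 : α * (lam * R) ^ 2 ≤ α * (lam * R * (1 / 3)) := by
      rw [sq]; gcongr
    have h4 : 0 ≤ α * (lam * R) := by positivity
    linarith

end Noise

/-! ### Momentum error and descent along a trajectory. -/

section Run

variable {d : ℕ} {Ξ : Type*}

/-- One step of the algorithm as a function of the state and the samples. -/
def stepMap (G : EuclideanSpace ℝ (Fin d) → Ξ → EuclideanSpace ℝ (Fin d))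
    (H : EuclideanSpace ℝ (Fin d) → Ξ →
      (EuclideanSpace ℝ (Fin d) →L[ℝ] EuclideanSpace ℝ (Fin d)))
    (γ α lam₁ lam₂ : ℝ)
    (s : (EuclideanSpace ℝ (Fin d) × EuclideanSpace ℝ (Fin d) × EuclideanSpace ℝ (Fin d)) ×
      (ℝ × Ξ × Ξ)) :
    EuclideanSpace ℝ (Fin d) × EuclideanSpace ℝ (Fin d) × EuclideanSpace ℝ (Fin d) :=
  let g := (1 - α) • (s.1.2.2 + clip (H (s.2.1 • s.1.2.1 + (1 - s.2.1) • s.1.1) s.2.2.2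
      (s.1.2.1 - s.1.1)) lam₁) + α • clip (G s.1.2.1 s.2.2.1) lam₂
  (s.1.2.1, normalizedStep γ s.1.2.1 g, g)

/-- The exponentially weighted sum of the noise along a run of the algorithm. -/
def noiseSum (F : EuclideanSpace ℝ (Fin d) → ℝ)
    (G : EuclideanSpace ℝ (Fin d) → Ξ → EuclideanSpace ℝ (Fin d))
    (H : EuclideanSpace ℝ (Fin d) → Ξ →
      (EuclideanSpace ℝ (Fin d) →L[ℝ] EuclideanSpace ℝ (Fin d)))
    (γ α lam₁ lam₂ : ℝ) (x₀ : EuclideanSpace ℝ (Fin d)) (u : ℕ → ℝ) (ξ ξ' : ℕ → Ξ) :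
    ℕ → EuclideanSpace ℝ (Fin d)
  | 0 => 0
  | t + 1 => (1 - α) • noiseSum F G H γ α lam₁ lam₂ x₀ u ξ ξ' t +
      noise F G H α lam₁ lam₂
        (run G H γ α lam₁ lam₂ x₀ 0 u ξ ξ' t, (u (t + 1), ξ (t + 1), ξ' (t + 1)))

variable {F : EuclideanSpace ℝ (Fin d) → ℝ}
    {G : EuclideanSpace ℝ (Fin d) → Ξ → EuclideanSpace ℝ (Fin d)}
    {H : EuclideanSpace ℝ (Fin d) → Ξ →
      (EuclideanSpace ℝ (Fin d) →L[ℝ] EuclideanSpace ℝ (Fin d))}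
    {α lam₁ lam₂ L₁ L₂ γ : ℝ} {x₀ g₀ : EuclideanSpace ℝ (Fin d)}
    {u : ℕ → ℝ} {ξ ξ' : ℕ → Ξ}

lemma run_snd_fst (t : ℕ) :
    (run G H γ α lam₁ lam₂ x₀ g₀ u ξ ξ' t).2.1 =
      normalizedStep γ (run G H γ α lam₁ lam₂ x₀ g₀ u ξ ξ' t).1
        (run G H γ α lam₁ lam₂ x₀ g₀ u ξ ξ' t).2.2 := by
  cases t <;> rfl

lemma norm_run_sub_le (hγ : 0 ≤ γ) (t : ℕ) :
    ‖(run G H γ α lam₁ lam₂ x₀ g₀ u ξ ξ' t).2.1 - (run G H γ α lam₁ lam₂ x₀ g₀ u ξ ξ' t).1‖ ≤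
      γ := by
  rw [run_snd_fst]
  exact norm_normalizedStep_sub_le hγ _ _

lemma measurable_stepMap [MeasurableSpace Ξ] (hG : Measurable (Function.uncurry G))
    (hH : Measurable (Function.uncurry H)) : Measurable (stepMap G H γ α lam₁ lam₂) := by
  have hx : Measurable fun s : (EuclideanSpace ℝ (Fin d) × EuclideanSpace ℝ (Fin d) ×
      EuclideanSpace ℝ (Fin d)) × (ℝ × Ξ × Ξ) => s.2.1 • s.1.2.1 + (1 - s.2.1) • s.1.1 := by
    fun_prop
  have hv : Measurable fun s : (EuclideanSpace ℝ (Fin d) × EuclideanSpace ℝ (Fin d) ×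
      EuclideanSpace ℝ (Fin d)) × (ℝ × Ξ × Ξ) => s.1.2.1 - s.1.1 := by fun_prop
  have hs : Measurable fun s : (EuclideanSpace ℝ (Fin d) × EuclideanSpace ℝ (Fin d) ×
      EuclideanSpace ℝ (Fin d)) × (ℝ × Ξ × Ξ) => s.1.2.1 := by fun_prop
  have hG1 : Measurable fun s : (EuclideanSpace ℝ (Fin d) × EuclideanSpace ℝ (Fin d) ×
      EuclideanSpace ℝ (Fin d)) × (ℝ × Ξ × Ξ) => clip (G s.1.2.1 s.2.2.1) lam₂ :=
    (measurable_clip lam₂).comp (hG.comp (.prodMk (by fun_prop) (by fun_prop)))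
  have hH1 : Measurable fun s : (EuclideanSpace ℝ (Fin d) × EuclideanSpace ℝ (Fin d) ×
      EuclideanSpace ℝ (Fin d)) × (ℝ × Ξ × Ξ) => clip (H (s.2.1 • s.1.2.1 + (1 - s.2.1) • s.1.1)
        s.2.2.2 (s.1.2.1 - s.1.1)) lam₁ := (measurable_clip lam₁).comp
    (measurable_apply_oracle hH hx (measurable_snd.comp (measurable_snd.comp measurable_snd)) hv)
  have hg : Measurable fun s : (EuclideanSpace ℝ (Fin d) × EuclideanSpace ℝ (Fin d) ×
      EuclideanSpace ℝ (Fin d)) × (ℝ × Ξ × Ξ) => (1 - α) • (s.1.2.2 +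
        clip (H (s.2.1 • s.1.2.1 + (1 - s.2.1) • s.1.1) s.2.2.2 (s.1.2.1 - s.1.1)) lam₁) +
        α • clip (G s.1.2.1 s.2.2.1) lam₂ := by fun_prop
  exact hs.prodMk (.prodMk (hs.sub ((hg.norm.inv.smul hg).const_smul γ)) hg)

/-- The momentum error is the noise sum up to a geometrically decaying term and the
discretization error of the Hessian correction. -/
lemma norm_momentum_error_le (hF : HessianLipschitz F L₂) (hL : 0 ≤ L₂) (hγ : 0 ≤ γ) (hα0 : 0 < α)
    (hα1 : α ≤ 1) (hu : ∀ t, u t ∈ Set.Icc (0 : ℝ) 1) (t : ℕ)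
    (hg : ∀ s ≤ t, ‖gradient F (run G H γ α lam₁ lam₂ x₀ 0 u ξ ξ' s).1‖ ≤ lam₂ / 2) :
    ‖(run G H γ α lam₁ lam₂ x₀ 0 u ξ ξ' t).2.2 -
        gradient F (run G H γ α lam₁ lam₂ x₀ 0 u ξ ξ' t).1 -
        noiseSum F G H γ α lam₁ lam₂ x₀ u ξ ξ' t‖ ≤
      (1 - α) ^ t * ‖gradient F x₀‖ + L₂ * γ ^ 2 / α := by
  induction t with
  | zero =>
    have : 0 ≤ L₂ * γ ^ 2 / α := by positivity
    simpa [run, noiseSum] using this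
  | succ t ih =>
    have ih := ih fun s hs => hg s (by omega)
    have hgt := hg (t + 1) le_rfl
    have hstep := norm_run_sub_le (G := G) (H := H) (α := α) (lam₁ := lam₁) (lam₂ := lam₂)
      (x₀ := x₀) (g₀ := 0) (u := u) (ξ := ξ) (ξ' := ξ') hγ t
    simp only [run] at hgt ⊢
    simp only [noiseSum, noise, hgt, if_true]
    set s := run G H γ α lam₁ lam₂ x₀ 0 u ξ ξ' t
    have hT := hF.norm_gradient_sub_le hL s.1 s.2.1 (hu (t + 1))
    set xh := u (t + 1) • s.2.1 + (1 - u (t + 1)) • s.1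
    set S := noiseSum F G H γ α lam₁ lam₂ x₀ u ξ ξ' t
    -- The noise cancels exactly: what remains is the contracted previous difference and the Taylor
    -- remainder of the gradient.
    have heq : ∀ c₁ c₂ : EuclideanSpace ℝ (Fin d),
        (1 - α) • (s.2.2 + c₁) + α • c₂ - gradient F s.2.1 - ((1 - α) • S +
          ((1 - α) • (c₁ - hessian F xh (s.2.1 - s.1)) + α • (c₂ - gradient F s.2.1))) =
        (1 - α) • (s.2.2 - gradient F s.1 - S) - (1 - α) • (gradient F s.2.1 - gradient F s.1
          - hessian F xh (s.2.1 - s.1)) := fun c₁ c₂ => by module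
    rw [heq]
    have hα' : 0 ≤ 1 - α := by linarith
    refine (norm_sub_le _ _).trans ?_
    rw [norm_smul, norm_smul, Real.norm_of_nonneg hα']
    have h1 : L₂ * ‖s.2.1 - s.1‖ ^ 2 ≤ L₂ * γ ^ 2 := by gcongr
    have h2 := mul_le_mul_of_nonneg_left ih hα'
    have h3 := mul_le_mul_of_nonneg_left (hT.trans h1) hα'
    -- With `w = L₂γ²/α` the bound closes because `(1 - α)(w + αw) = (1 - α²)w ≤ w`.
    have h4 : L₂ * γ ^ 2 = α * (L₂ * γ ^ 2 / α) := by field_simp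
    have h5 : 0 ≤ L₂ * γ ^ 2 / α := by positivity
    set w := L₂ * γ ^ 2 / α
    rw [h4] at h3
    have h6 : 0 ≤ α ^ 2 * w := by positivity
    rw [pow_succ]
    linarith

/-- Convergence on the event that the noise sums are small. -/
lemma sum_norm_gradient_le (hb : BddBelow (Set.range F)) (hF1 : GradientLipschitz F L₁)
    (hL₁ : 0 ≤ L₁) (hF : HessianLipschitz F L₂) (hL : 0 ≤ L₂) (hγ : 0 ≤ γ) (hα0 : 0 < α)
    (hα1 : α ≤ 1) (hu : ∀ t, u t ∈ Set.Icc (0 : ℝ) 1) {T : ℕ} {B Δ : ℝ}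
    (hΔ : Δ = F x₀ - ⨅ x, F x) (hB : 0 ≤ B)
    (hS : ∀ t < T, ‖noiseSum F G H γ α lam₁ lam₂ x₀ u ξ ξ' t‖ ≤ B)
    (hlam : 4 * √(L₁ * Δ) ≤ lam₂)
    (hbudget : 2 * γ * (‖gradient F x₀‖ / α + T * (L₂ * γ ^ 2 / α + B)) +
      T * (L₁ / 2 * γ ^ 2) ≤ Δ) :
    γ * ∑ t ∈ Finset.range T, ‖gradient F (iterate G H γ α lam₁ lam₂ x₀ 0 u ξ ξ' t)‖ ≤
      2 * Δ := by
  set x : ℕ → EuclideanSpace ℝ (Fin d) := iterate G H γ α lam₁ lam₂ x₀ 0 u ξ ξ' with hx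
  have hΔ0 : 0 ≤ Δ := hΔ ▸ sub_nonneg.2 (ciInf_le hb x₀)
  have hα' : 0 ≤ 1 - α := by linarith
  set b : ℕ → ℝ := fun s => 2 * γ * ((1 - α) ^ s * ‖gradient F x₀‖ + (L₂ * γ ^ 2 / α + B)) +
    L₁ / 2 * γ ^ 2 with hbdef
  have hbsum : ∀ t ≤ T, ∑ s ∈ Finset.range t, b s ≤ Δ := by
    intro t ht
    refine le_trans ?_ hbudget
    have hgeom : ∑ s ∈ Finset.range t, (1 - α) ^ s ≤ 1 / α := by
      have h := geom_sum_mul (1 - α) t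
      rw [le_div_iff₀ hα0]
      nlinarith [pow_nonneg hα' t]
    have htT : (t : ℝ) ≤ T := by exact_mod_cast ht
    have hsum : ∑ s ∈ Finset.range t, b s = 2 * γ * ((∑ s ∈ Finset.range t, (1 - α) ^ s) *
        ‖gradient F x₀‖ + t * (L₂ * γ ^ 2 / α + B)) + t * (L₁ / 2 * γ ^ 2) := by
      simp only [hbdef, Finset.sum_add_distrib, ← Finset.mul_sum, ← Finset.sum_mul,
        Finset.sum_const, Finset.card_range, nsmul_eq_mul]
      ring
    calc ∑ s ∈ Finset.range t, b s = _ := hsum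
      _ ≤ 2 * γ * (1 / α * ‖gradient F x₀‖ + T * (L₂ * γ ^ 2 / α + B)) +
          T * (L₁ / 2 * γ ^ 2) := by gcongr
      _ = _ := by ring
  have hmain : ∀ t ≤ T, F (x t) + γ * ∑ s ∈ Finset.range t, ‖gradient F (x s)‖ ≤
      F x₀ + ∑ s ∈ Finset.range t, b s := by
    intro t
    induction t using Nat.strong_induction_on with
    | _ t ih =>
      intro htT
      rcases t with _ | t
      · simp [hx, iterate, run]
      -- Bootstrap: the descent bound at earlier times gives `F(x_s) - inf F ≤ 2Δ`, so the gradient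
      -- is at most `2√(L₁Δ) ≤ lam₂ / 2` and the truncation in `noise` is inactive up to time `t`.
      · have hgrad : ∀ s ≤ t, ‖gradient F (x s)‖ ≤ lam₂ / 2 := by
          intro s hs
          have h1 := ih s (by omega) (by omega)
          have h2 := hbsum s (by omega)
          have h3 : 0 ≤ γ * ∑ r ∈ Finset.range s, ‖gradient F (x r)‖ := by positivity
          have h4 := hF1.norm_gradient_sq_le hL₁ hb (x s)
          have h5 : 2 * L₁ * (F (x s) - ⨅ y, F y) ≤ 2 * L₁ * (2 * Δ) := by
            gcongr
            linarith
          have h6 : ‖gradient F (x s)‖ ≤ 2 * √(L₁ * Δ) := by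
            refine abs_le_of_sq_le_sq' ?_ (by positivity) |>.2
            rw [mul_pow, Real.sq_sqrt (by positivity)]
            linarith
          linarith
        have h1 := norm_momentum_error_le (G := G) (H := H) (lam₁ := lam₁) (x₀ := x₀) (ξ := ξ)
          (ξ' := ξ') hF hL hγ hα0 hα1 hu t hgrad
        have h2 := hF1.normalizedStep_le hL₁ hγ (x t) (run G H γ α lam₁ lam₂ x₀ 0 u ξ ξ' t).2.2
        have h3 : normalizedStep γ (x t) (run G H γ α lam₁ lam₂ x₀ 0 u ξ ξ' t).2.2 = x (t + 1) :=
          (run_snd_fst t).symm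
        have h4 := ih t (by omega) (by omega)
        have h5 : ‖(run G H γ α lam₁ lam₂ x₀ 0 u ξ ξ' t).2.2 - gradient F (x t)‖ ≤
            (1 - α) ^ t * ‖gradient F x₀‖ + (L₂ * γ ^ 2 / α + B) := by
          have h6 := norm_add_le ((run G H γ α lam₁ lam₂ x₀ 0 u ξ ξ' t).2.2 - gradient F (x t) -
            noiseSum F G H γ α lam₁ lam₂ x₀ u ξ ξ' t) (noiseSum F G H γ α lam₁ lam₂ x₀ u ξ ξ' t)
          rw [sub_add_cancel] at h6
          have h7 := hS t (by omega)
          have h8 : ‖(run G H γ α lam₁ lam₂ x₀ 0 u ξ ξ' t).2.2 - gradient F (x t) -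
            noiseSum F G H γ α lam₁ lam₂ x₀ u ξ ξ' t‖ ≤ _ := h1
          linarith
        rw [h3] at h2
        have h9 := mul_le_mul_of_nonneg_left h5 (by positivity : 0 ≤ 2 * γ)
        rw [Finset.sum_range_succ, Finset.sum_range_succ]
        simp only [hbdef] at h4 ⊢
        linarith
  have h1 := hmain T le_rfl
  have h2 := hbsum T le_rfl
  have h3 := ciInf_le hb (x T)
  linarith

end Run

/-! ### Tail bound for the algorithm's noise. -/

section Tail

variable {d : ℕ} {Ξ : Type*} [MeasurableSpace Ξ] {F : EuclideanSpace ℝ (Fin d) → ℝ}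
    {G : EuclideanSpace ℝ (Fin d) → Ξ → EuclideanSpace ℝ (Fin d)}
    {H : EuclideanSpace ℝ (Fin d) → Ξ →
      (EuclideanSpace ℝ (Fin d) →L[ℝ] EuclideanSpace ℝ (Fin d))}
    {α lam₁ lam₂ p q σ₁ σ₂ L₁ L₂ γ : ℝ} {D : Measure Ξ} [IsProbabilityMeasure D]
    {Ω : Type*} [MeasurableSpace Ω] {P : Measure Ω} [IsProbabilityMeasure P]
    {u : ℕ → Ω → ℝ} {ξ ξ' : ℕ → Ω → Ξ}

instance isProbabilityMeasure_unitInterval :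
    IsProbabilityMeasure (volume.restrict (Set.Icc (0 : ℝ) 1)) := ⟨by simp⟩

/-- Subexponential tails of the noise sums. -/
lemma measure_noiseSum_ge_le (hF1 : GradientLipschitz F L₁) (hL₁ : 0 ≤ L₁)
    (hF : HessianLipschitz F L₂) (hG : GradientBCM D F G p σ₁) (hp : 1 ≤ p) (hp2 : p ≤ 2)
    (hH : HessianBCM D F H q σ₂) (hq : 1 ≤ q) (hq2 : q ≤ 2) (hσ₂ : 0 ≤ σ₂)
    (hsamp : Sampling P D u ξ ξ') (hα0 : 0 ≤ α) (hα1 : α ≤ 1) (hγ : 0 ≤ γ)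
    (hl₁ : 0 < lam₁) (hl₂ : 0 < lam₂) (hσl₁ : (γ * σ₂) ^ q ≤ α * lam₁ ^ q)
    (hσl₂ : σ₁ ^ p ≤ α * lam₂ ^ p) (hLl : 2 * γ * L₁ ≤ lam₁) (x₀ : EuclideanSpace ℝ (Fin d))
    (t : ℕ) (a : ℝ) :
    P {ω | 3 * (lam₁ + α * lam₂) * (4 + a) ≤ ‖noiseSum F G H γ α lam₁ lam₂ x₀ (fun s => u s ω)
      (fun s => ξ s ω) (fun s => ξ' s ω) t‖} ≤ ENNReal.ofReal (Real.exp (-a)) := by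
  have hR : 0 < lam₁ + α * lam₂ := by positivity
  set R := lam₁ + α * lam₂
  let ζ : ℕ → Ω → ℝ × Ξ × Ξ := fun t ω => (u t ω, ξ t ω, ξ' t ω)
  let W : ℕ → Ω → EuclideanSpace ℝ (Fin d) × EuclideanSpace ℝ (Fin d) × EuclideanSpace ℝ (Fin d) :=
    fun t ω => run G H γ α lam₁ lam₂ x₀ 0 (fun s => u s ω) (fun s => ξ s ω) (fun s => ξ' s ω) t
  let N : ℕ → Ω → EuclideanSpace ℝ (Fin d) := fun t ω =>
    noiseSum F G H γ α lam₁ lam₂ x₀ (fun s => u s ω) (fun s => ξ s ω) (fun s => ξ' s ω) t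
  have hζ : ∀ t, Measurable (ζ t) := fun t =>
    (hsamp.measurable_u t).prodMk ((hsamp.measurable_grad t).prodMk (hsamp.measurable_hess t))
  have hΨ : Measurable (stepMap G H γ α lam₁ lam₂) := measurable_stepMap hG.measurable hH.measurable
  have hθ : Measurable (noise F G H α lam₁ lam₂) := measurable_noise hF hG.measurable hH.measurable
  have hrec : ∀ t ω, (W (t + 1) ω, N (t + 1) ω) = (stepMap G H γ α lam₁ lam₂ (W t ω, ζ (t + 1) ω),
      (1 - α) • N t ω + noise F G H α lam₁ lam₂ (W t ω, ζ (t + 1) ω)) := fun t ω => rfl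
  have hlam : 0 ≤ 1 / (3 * R) := by positivity
  have hlamR : 1 / (3 * R) * R = 1 / 3 := by field_simp
  have hexp := lintegral_potential_le_of_recursion (Y := fun t ω => (W t ω, N t ω)) (P := P)
    (ζ := ζ) hΨ hθ (s := (x₀, normalizedStep γ x₀ 0, 0)) (fun ω => rfl) hrec hζ hsamp.indep
    hsamp.law hα0 hα1 (R := R) (K := 8) hR.le (fun t ω lam hl hlR y => by
      have hm : Measurable fun z => ENNReal.ofReal
          (potential (y + lam • noise F G H α lam₁ lam₂ (W t ω, z))) := by
        have := (continuous_potential (E := EuclideanSpace ℝ (Fin d))).measurable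
        fun_prop
      -- The uniform variable is frozen as `v`, and only the two oracle samples are averaged.
      rw [lintegral_prod _ hm.aemeasurable]
      refine (lintegral_mono (g := fun _ => ENNReal.ofReal (Real.exp (8 * α * (lam * R))) *
        ENNReal.ofReal (potential y)) fun v => ?_).trans (by simp)
      exact (smallNoise_hess hH hF1 hL₁ hq hq2 hl₁ hσl₁ hσ₂ hLl
        (v • (W t ω).2.1 + (1 - v) • (W t ω).1) _ (norm_run_sub_le hγ t)).lintegral_potential_le
        (smallNoise_grad hG hp hp2 hl₂ hα0 hσl₂ (W t ω).2.1) hα0 hα1 hl₁.le hl₂.le hl hlR y)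
    t hlam hlamR.le (by norm_num)
  have hN : Measurable (N t) := measurable_snd.comp
    (measurable_of_recursion (Y := fun t ω => (W t ω, N t ω)) (ζ := ζ)
      (Ψ := fun y => (stepMap G H γ α lam₁ lam₂ (y.1.1, y.2),
        (1 - α) • y.1.2 + noise F G H α lam₁ lam₂ (y.1.1, y.2))) (by fun_prop)
      (s := ((x₀, normalizedStep γ x₀ 0, 0), 0)) (fun ω => rfl) hrec hζ t)
  -- At `lam = 1 / (3R)` the moment exponent is `1 + 8/3`, which the shift by `4` absorbs.
  have htail := measure_le_norm_of_lintegral_potential hN hlam hexp (4 + a)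
  refine (measure_mono fun ω hω => ?_).trans (htail.trans ?_)
  · change 4 + a ≤ 1 / (3 * R) * ‖N t ω‖
    rw [one_div, le_inv_mul_iff₀ (by positivity)]
    exact Set.mem_ofPred.1 hω
  · gcongr
    linarith

end Tail

/-! ### Stepsize constraints, error budget and rate. -/

section Parameters

variable {L₁ L₂ σ₁ σ₂ Δ p q α ℓ : ℝ} {T : ℕ}

lemma sqrt_div_mul_self (hΔ : 0 < Δ) (L : ℝ) : √(L / Δ) * Δ = √(L * Δ) := by
  rw [show L * Δ = L / Δ * Δ ^ 2 by field_simp, Real.sqrt_mul' _ (by positivity),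
    Real.sqrt_sq hΔ.le]

lemma rpow_third_pow_three {x : ℝ} (hx : 0 ≤ x) : (x ^ ((1 : ℝ) / 3)) ^ 3 = x := by
  rw [← Real.rpow_natCast, ← Real.rpow_mul hx]
  norm_num

/-- Division by zero makes all six reciprocals vanish, and so does the inverse of their maximum.
This matches the convention for `Δ = 0`, so a positive stepsize forces a positive gap. -/
lemma stepScale_of_zero_gap : stepScale L₁ L₂ σ₁ σ₂ 0 p q α ℓ T = 0 := by
  simp [stepScale]

/-- The largest stepsize scale meets each of its six constraints. -/
lemma stepScale_constraints {m : ℝ} (hm : m = (stepScale L₁ L₂ σ₁ σ₂ Δ p q α ℓ T)⁻¹) :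
    √(L₁ / Δ) / α ≤ m ∧ (L₂ * T / (Δ * α)) ^ ((1 : ℝ) / 3) ≤ m ∧
    α * T * ℓ * √(L₁ / Δ) ≤ m ∧ σ₁ * α ^ ((p - 1) / p) * T * ℓ / Δ ≤ m ∧
    √(σ₂ * T * ℓ / (Δ * α ^ (1 / q))) ≤ m ∧ √(L₁ * T * ℓ / Δ) ≤ m := by
  rw [stepScale, inv_inv] at hm
  subst hm
  simp

lemma inv_stepScale_le (hα : 0 ≤ α) (hℓ : 0 ≤ ℓ) (hΔ : 0 ≤ Δ) (hL₂ : 0 ≤ L₂) (hσ₁ : 0 ≤ σ₁) :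
    (stepScale L₁ L₂ σ₁ σ₂ Δ p q α ℓ T)⁻¹ ≤
      √(L₁ / Δ) / α + (L₂ * T / (Δ * α)) ^ ((1 : ℝ) / 3) + α * T * ℓ * √(L₁ / Δ) +
      σ₁ * α ^ ((p - 1) / p) * T * ℓ / Δ + √(σ₂ * T * ℓ / (Δ * α ^ (1 / q))) +
      √(L₁ * T * ℓ / Δ) := by
  rw [stepScale, inv_inv]
  have h1 : 0 ≤ √(L₁ / Δ) / α := by positivity
  have h2 : 0 ≤ (L₂ * T / (Δ * α)) ^ ((1 : ℝ) / 3) := by positivity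
  have h3 : 0 ≤ α * T * ℓ * √(L₁ / Δ) := by positivity
  have h4 : 0 ≤ σ₁ * α ^ ((p - 1) / p) * T * ℓ / Δ := by positivity
  have h5 : 0 ≤ √(σ₂ * T * ℓ / (Δ * α ^ (1 / q))) := by positivity
  have h6 : 0 ≤ √(L₁ * T * ℓ / Δ) := by positivity
  simp only [max_le_iff]
  refine ⟨?_, ?_, ?_, ?_, ?_, ?_⟩ <;> linarith

/-- The stepsize makes the total error of a run at most the initial gap. -/
lemma total_error_le {c γ a lam₁ lam₂ : ℝ} (hL₁ : 0 ≤ L₁) (hL₂ : 0 ≤ L₂) (hσ₁ : 0 < σ₁)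
    (hσ₂ : 0 < σ₂) (hΔ : 0 < Δ) (hp : 1 < p) (hα0 : 0 < α) (hℓ : 1 / 2 ≤ ℓ)
    (hT : 1 ≤ T) (hc : 0 < c) (hc1 : c ≤ 1 / 400) (hγ : 0 < γ)
    (hγc : γ = c * stepScale L₁ L₂ σ₁ σ₂ Δ p q α ℓ T) (ha2 : a ^ 2 ≤ 2 * L₁ * Δ)
    (hl₁ : lam₁ = max (2 * γ * L₁) (γ * σ₂ * α ^ (-(1 / q))))
    (hl₂ : lam₂ = max (4 * √(L₁ * Δ)) (σ₁ * α ^ (-(1 / p)))) :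
    2 * γ * (a / α + T * (L₂ * γ ^ 2 / α + 21 * ℓ * (lam₁ + α * lam₂))) +
      T * (L₁ / 2 * γ ^ 2) ≤ Δ := by
  have hT1 : (1 : ℝ) ≤ T := by exact_mod_cast hT
  have hT0 : (0 : ℝ) < T := by linarith
  have hℓ0 : 0 < ℓ := by linarith
  obtain ⟨m, hm⟩ : ∃ m, m = (stepScale L₁ L₂ σ₁ σ₂ Δ p q α ℓ T)⁻¹ := ⟨_, rfl⟩
  obtain ⟨h1, h2, h3, h4, h5, h6⟩ := stepScale_constraints hm
  have hγm : γ * m = c := by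
    have : stepScale L₁ L₂ σ₁ σ₂ Δ p q α ℓ T ≠ 0 := by
      rintro h
      rw [h, mul_zero] at hγc
      exact hγ.ne' hγc
    rw [hm, hγc, mul_assoc, mul_inv_cancel₀ this, mul_one]
  have hsq : ∀ x : ℝ, 0 ≤ x → √x ≤ m → γ ^ 2 * x ≤ c := by
    intro x hx hxm
    have h : γ * √x ≤ c := hγm ▸ mul_le_mul_of_nonneg_left hxm hγ.le
    calc γ ^ 2 * x = (γ * √x) ^ 2 := by rw [mul_pow, Real.sq_sqrt hx]
      _ ≤ c ^ 2 := by gcongr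
      _ ≤ c := by nlinarith
  set s := √(L₁ * Δ) with hs
  have hs' : √(L₁ / Δ) * Δ = s := sqrt_div_mul_self hΔ L₁
  have k1 : γ * (s / α) ≤ c * Δ := by
    have := mul_le_mul_of_nonneg_left h1 hγ.le
    rw [hγm] at this
    calc γ * (s / α) = γ * (√(L₁ / Δ) / α) * Δ := by rw [← hs']; ring
      _ ≤ _ := by gcongr
  have k2 : γ ^ 3 * L₂ * T / α ≤ c * Δ := by
    have h := mul_le_mul_of_nonneg_left h2 hγ.le
    rw [hγm] at h
    calc γ ^ 3 * L₂ * T / α = (γ * (L₂ * T / (Δ * α)) ^ ((1 : ℝ) / 3)) ^ 3 * Δ := by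
          rw [mul_pow, rpow_third_pow_three (by positivity)]
          field_simp
      _ ≤ c ^ 3 * Δ := by gcongr
      _ ≤ c * Δ := by
        gcongr
        exact pow_le_of_le_one hc.le (by linarith) (by norm_num)
  have k3 : γ * (α * T * ℓ * s) ≤ c * Δ := by
    have := mul_le_mul_of_nonneg_left h3 hγ.le
    rw [hγm] at this
    calc γ * (α * T * ℓ * s) = γ * (α * T * ℓ * √(L₁ / Δ)) * Δ := by rw [← hs']; ring
      _ ≤ _ := by gcongr
  have k4 : γ * (σ₁ * α ^ ((p - 1) / p) * T * ℓ) ≤ c * Δ := by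
    have := mul_le_mul_of_nonneg_left h4 hγ.le
    rw [hγm] at this
    calc γ * (σ₁ * α ^ ((p - 1) / p) * T * ℓ)
        = γ * (σ₁ * α ^ ((p - 1) / p) * T * ℓ / Δ) * Δ := by field_simp
      _ ≤ _ := by gcongr
  have k5 : γ ^ 2 * (σ₂ * T * ℓ * α ^ (-(1 / q))) ≤ c * Δ := by
    have := hsq _ (by positivity) h5
    have hα' : 0 < α ^ (1 / q) := by positivity
    calc γ ^ 2 * (σ₂ * T * ℓ * α ^ (-(1 / q)))
        = γ ^ 2 * (σ₂ * T * ℓ / (Δ * α ^ (1 / q))) * Δ := by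
          rw [Real.rpow_neg hα0.le]
          field_simp
      _ ≤ _ := by gcongr
  have k6 : γ ^ 2 * (L₁ * T * ℓ) ≤ c * Δ := by
    have := hsq _ (by positivity) h6
    calc γ ^ 2 * (L₁ * T * ℓ) = γ ^ 2 * (L₁ * T * ℓ / Δ) * Δ := by field_simp
      _ ≤ _ := by gcongr
  have hs2 : s ^ 2 = L₁ * Δ := Real.sq_sqrt (by positivity)
  have has : a ≤ 2 * s := by
    refine abs_le_of_sq_le_sq' ?_ (by positivity) |>.2
    nlinarith [mul_nonneg hL₁ hΔ.le]
  have hl₁' : lam₁ ≤ 2 * γ * L₁ + γ * σ₂ * α ^ (-(1 / q)) := by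
    rw [hl₁]
    exact max_le_add_of_nonneg (by positivity) (by positivity)
  have hl₂' : α * lam₂ ≤ 4 * α * s + σ₁ * α ^ ((p - 1) / p) := by
    have h : lam₂ ≤ 4 * s + σ₁ * α ^ (-(1 / p)) := by
      rw [hl₂]
      exact max_le_add_of_nonneg (by positivity) (by positivity)
    have hpow : α ^ ((p - 1) / p) = α * α ^ (-(1 / p)) := by
      rw [← Real.rpow_one_add' hα0.le (by
        have : 0 < (p - 1) / p := div_pos (by linarith) (by linarith)
        have h' : (p - 1) / p = 1 + -(1 / p) := by field_simp; ring
        linarith)]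
      congr 1
      field_simp
      ring
    calc α * lam₂ ≤ α * (4 * s + σ₁ * α ^ (-(1 / p))) := by gcongr
      _ = _ := by rw [hpow]; ring
  have e1 : 2 * γ * (a / α) ≤ 4 * (c * Δ) := by
    calc 2 * γ * (a / α) ≤ 2 * γ * (2 * s / α) := by gcongr
      _ = 4 * (γ * (s / α)) := by ring
      _ ≤ _ := by gcongr
  have e2 : 2 * γ * (T * (L₂ * γ ^ 2 / α)) ≤ 2 * (c * Δ) := by
    calc 2 * γ * (T * (L₂ * γ ^ 2 / α)) = 2 * (γ ^ 3 * L₂ * T / α) := by ring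
      _ ≤ _ := by gcongr
  -- The total over `e1` to `e4` is `4 + 2 + 336 + 1 = 343`, which explains the bound `c ≤ 1 / 400`.
  have e3 : 2 * γ * (T * (21 * ℓ * (lam₁ + α * lam₂))) ≤ 336 * (c * Δ) := by
    calc 2 * γ * (T * (21 * ℓ * (lam₁ + α * lam₂)))
        ≤ 2 * γ * (T * (21 * ℓ * ((2 * γ * L₁ + γ * σ₂ * α ^ (-(1 / q))) +
          (4 * α * s + σ₁ * α ^ ((p - 1) / p))))) := by gcongr
      _ = 84 * (γ ^ 2 * (L₁ * T * ℓ)) + 42 * (γ ^ 2 * (σ₂ * T * ℓ * α ^ (-(1 / q)))) +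
          168 * (γ * (α * T * ℓ * s)) + 42 * (γ * (σ₁ * α ^ ((p - 1) / p) * T * ℓ)) := by ring
      _ ≤ _ := by linarith
  have e4 : T * (L₁ / 2 * γ ^ 2) ≤ c * Δ := by
    calc T * (L₁ / 2 * γ ^ 2) = γ ^ 2 * (L₁ * T * (1 / 2)) := by ring
      _ ≤ γ ^ 2 * (L₁ * T * ℓ) := by gcongr
      _ ≤ _ := k6
  have e5 : c * Δ ≤ 1 / 400 * Δ := by gcongr
  linarith

lemma momentum_pos (hT : 1 ≤ T) : 0 < momentum p q T :=
  lt_max_of_lt_left (Real.rpow_pos_of_pos (by exact_mod_cast hT) _)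

lemma momentum_le_one (hT : 1 ≤ T) (hp : 1 < p) (hq : 1 ≤ q) : momentum p q T ≤ 1 := by
  have hT1 : (1 : ℝ) ≤ T := by exact_mod_cast hT
  have hD : 0 < p * (2 * q + 1) - 2 * q := by nlinarith
  refine max_le (Real.rpow_le_one_of_one_le_of_nonpos hT1 ?_)
    (Real.rpow_le_one_of_one_le_of_nonpos hT1 ?_)
  · exact neg_nonpos.2 (div_nonneg (by linarith) (by linarith))
  · exact neg_nonpos.2 (div_nonneg (by nlinarith) hD.le)

set_option maxHeartbeats 800000 in
/-- For the chosen momentum, the stepsize scale gives the claimed rate. -/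
lemma gap_mul_inv_stepScale_le (hL₁ : 0 ≤ L₁) (hL₂ : 0 ≤ L₂) (hσ₁ : 0 < σ₁)
    (hσ₂ : 0 < σ₂) (hΔ : 0 < Δ) (hp : 1 < p) (hq : 1 ≤ q)
    (hα : α = momentum p q T) (hℓ : 1 / 2 ≤ ℓ) (hT : 1 ≤ T) :
    (stepScale L₁ L₂ σ₁ σ₂ Δ p q α ℓ T)⁻¹ * Δ / T ≤ 6 * rate L₁ L₂ σ₁ σ₂ Δ p q ℓ T := by
  have hT1 : (1 : ℝ) ≤ T := by exact_mod_cast hT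
  have hα0 : 0 < α := hα ▸ momentum_pos hT
  have hα1 : α ≤ 1 := hα ▸ momentum_le_one hT hp hq
  have hD : 0 < p * (2 * q + 1) - 2 * q := by nlinarith
  have hℓ0 : 0 < ℓ := by linarith
  have hinv := inv_stepScale_le (L₁ := L₁) (σ₂ := σ₂) (p := p) (q := q) (T := T)
    hα0.le hℓ0.le hΔ.le hL₂ hσ₁.le
  have hp2 : 0 < 2 * p - 1 := by linarith
  have hp4 : 0 < 4 * p - 3 := by linarith
  rw [momentum] at hα
  have hαl : (T : ℝ) ^ (-(p / (2 * p - 1))) ≤ α := hα ▸ le_max_left _ _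
  have hαr : (T : ℝ) ^ (-(p * q / (p * (2 * q + 1) - 2 * q))) ≤ α := hα ▸ le_max_right _ _
  set A := p * (2 * q + 1) - 2 * q with hA
  set τ : ℝ := (T : ℝ) with hτ
  have hτ0 : 0 < τ := by linarith
  have hmono : ∀ {a b : ℝ}, a ≤ b → τ ^ a ≤ τ ^ b := fun h =>
    Real.rpow_le_rpow_of_exponent_le hT1 h
  rw [rate, ← hτ, ← hA]
  set e := min ((p - 1) / (2 * p - 1)) (q * (p - 1) / A) with he
  have he1 : e ≤ (p - 1) / (2 * p - 1) := min_le_left _ _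
  have he2 : e ≤ q * (p - 1) / A := min_le_right _ _
  -- The first candidate for `α` balances `1 / (αT)` against `α^((p-1)/p)`, the second balances
  -- `(Tα^(1/q))^(-1/2)` against it. The larger candidate gives the smaller exponent `e`.
  have hαpow : α ^ ((p - 1) / p) ≤ τ ^ (-e) := by
    rcases max_choice (τ ^ (-(p / (2 * p - 1)))) (τ ^ (-(p * q / A))) with h | h
    · rw [hα, h, ← Real.rpow_mul hτ0.le]
      refine hmono ?_
      rw [show -(p / (2 * p - 1)) * ((p - 1) / p) = -((p - 1) / (2 * p - 1)) by field_simp]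
      linarith
    · rw [hα, h, ← Real.rpow_mul hτ0.le]
      refine hmono ?_
      rw [show -(p * q / A) * ((p - 1) / p) = -(q * (p - 1) / A) by field_simp]
      linarith
  have hαe : α ≤ τ ^ (-e) := by
    refine le_trans ?_ hαpow
    calc α = α ^ (1 : ℝ) := (Real.rpow_one α).symm
      _ ≤ _ := Real.rpow_le_rpow_of_exponent_ge hα0 hα1 ((div_le_one (by linarith)).2 (by linarith))
  have hαinv : 1 / α ≤ τ ^ (p / (2 * p - 1)) := by
    rw [Real.rpow_neg hτ0.le] at hαl
    rw [one_div]
    exact inv_le_of_inv_le₀ (by positivity) hαl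
  set s := √(L₁ * Δ) with hs
  have hs0 : 0 ≤ s := Real.sqrt_nonneg _
  have hs' : √(L₁ / Δ) * Δ = s := sqrt_div_mul_self hΔ L₁
  have hneg : ∀ x : ℝ, ∀ k : ℝ, x / τ ^ k = x * τ ^ (-k) := fun x k => by
    rw [Real.rpow_neg hτ0.le, div_eq_mul_inv]
  simp only [hneg]
  set X := τ ^ (-e) with hX
  have hX0 : 0 < X := by positivity
  have r1 : √(L₁ / Δ) / α * Δ / τ ≤ 2 * (s * X * ℓ) := by
    have h : 1 / α / τ ≤ X := by
      calc 1 / α / τ ≤ τ ^ (p / (2 * p - 1)) / τ := by gcongr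
        _ = τ ^ (p / (2 * p - 1) - 1) := by rw [Real.rpow_sub_one hτ0.ne']
        _ ≤ X := hmono (by
          have : p / (2 * p - 1) - 1 = -((p - 1) / (2 * p - 1)) := by
            rw [div_sub_one hp2.ne', ← neg_div]
            ring
          linarith)
    calc √(L₁ / Δ) / α * Δ / τ = s * (1 / α / τ) * 1 := by rw [← hs']; ring
      _ ≤ s * X * (2 * ℓ) := by gcongr; linarith
      _ = _ := by ring
  have r2 : (L₂ * τ / (Δ * α)) ^ ((1 : ℝ) / 3) * Δ / τ ≤
      (L₂ ^ ((1 : ℝ) / 2) * Δ) ^ ((2 : ℝ) / 3) * τ ^ (-(2 * (p - 1) / (4 * p - 3))) := by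
    refine (pow_le_pow_iff_left₀ (by positivity) (by positivity) (n := 3) (by norm_num)).1 ?_
    have h1 : ((L₂ ^ ((1 : ℝ) / 2) * Δ) ^ ((2 : ℝ) / 3)) ^ 3 = L₂ * Δ ^ 2 := by
      rw [← Real.rpow_natCast, ← Real.rpow_mul (by positivity)]
      norm_num
      rw [mul_pow, ← Real.rpow_natCast, ← Real.rpow_mul hL₂]
      norm_num
    have h2 : (τ ^ (-(2 * (p - 1) / (4 * p - 3)))) ^ 3 = τ ^ (-(6 * (p - 1) / (4 * p - 3))) := by
      rw [← Real.rpow_natCast, ← Real.rpow_mul hτ0.le]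
      congr 1
      push_cast
      ring
    rw [mul_pow, h1, h2, div_pow, mul_pow, rpow_third_pow_three (by positivity)]
    have h3 : 1 / α / τ ^ 2 ≤ τ ^ (-(6 * (p - 1) / (4 * p - 3))) := by
      calc 1 / α / τ ^ 2 ≤ τ ^ (p / (2 * p - 1)) / τ ^ 2 := by gcongr
        _ = τ ^ (p / (2 * p - 1) - 2) := by
          rw [Real.rpow_sub hτ0]
          norm_num
        _ ≤ _ := hmono (by
          rw [div_sub' hp2.ne', ← neg_div, div_le_div_iff₀ hp2 hp4]
          nlinarith)
    calc L₂ * τ / (Δ * α) * Δ ^ 3 / τ ^ 3 = L₂ * Δ ^ 2 * (1 / α / τ ^ 2) := by field_simp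
      _ ≤ _ := by gcongr
  have r3 : α * τ * ℓ * √(L₁ / Δ) * Δ / τ ≤ s * X * ℓ := by
    calc α * τ * ℓ * √(L₁ / Δ) * Δ / τ = s * α * ℓ := by rw [← hs']; field_simp
      _ ≤ _ := by gcongr
  have r4 : σ₁ * α ^ ((p - 1) / p) * τ * ℓ / Δ * Δ / τ ≤ σ₁ * X * ℓ := by
    calc σ₁ * α ^ ((p - 1) / p) * τ * ℓ / Δ * Δ / τ = σ₁ * α ^ ((p - 1) / p) * ℓ := by field_simp
      _ ≤ _ := by gcongr
  have r5 : √(σ₂ * τ * ℓ / (Δ * α ^ (1 / q))) * Δ / τ ≤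
      √(σ₂ * Δ) * τ ^ (-(q * (p - 1) / A)) * √ℓ := by
    refine (pow_le_pow_iff_left₀ (by positivity) (by positivity) (n := 2) (by norm_num)).1 ?_
    rw [mul_pow, mul_pow, div_pow, mul_pow, Real.sq_sqrt (by positivity),
      Real.sq_sqrt (by positivity), Real.sq_sqrt hℓ0.le]
    have h1 : (τ ^ (-(q * (p - 1) / A))) ^ 2 = τ ^ (p / A - 1) := by
      rw [← Real.rpow_natCast, ← Real.rpow_mul hτ0.le]
      congr 1
      push_cast
      field_simp
      rw [hA]
      ring
    have h2 : 1 / α ^ (1 / q) ≤ τ ^ (p / A) := by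
      have h := Real.rpow_le_rpow (by positivity) hαr (by positivity : 0 ≤ 1 / q)
      rw [← Real.rpow_mul hτ0.le, show -(p * q / A) * (1 / q) = -(p / A) by field_simp,
        Real.rpow_neg hτ0.le] at h
      rw [one_div (α ^ (1 / q))]
      exact inv_le_of_inv_le₀ (by positivity) h
    rw [h1, Real.rpow_sub_one hτ0.ne']
    have hαq : 0 < α ^ (1 / q) := by positivity
    calc σ₂ * τ * ℓ / (Δ * α ^ (1 / q)) * Δ ^ 2 / τ ^ 2
        = σ₂ * Δ * (1 / α ^ (1 / q) / τ) * ℓ := by field_simp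
      _ ≤ _ := by gcongr
  have r6 : √(L₁ * τ * ℓ / Δ) * Δ / τ ≤ 2 * (s * X * ℓ) := by
    refine (pow_le_pow_iff_left₀ (by positivity) (by positivity) (n := 2) (by norm_num)).1 ?_
    have hs2 : s ^ 2 = L₁ * Δ := Real.sq_sqrt (by positivity)
    rw [div_pow, mul_pow, Real.sq_sqrt (by positivity),
      show (2 * (s * X * ℓ)) ^ 2 = s ^ 2 * X ^ 2 * (2 * ℓ) ^ 2 by ring, hs2]
    -- The `√(L₁Δ/T)` term is absorbed because `e ≤ (p-1)/(2p-1) ≤ 1/2`. The loss from `√ℓ` to `2ℓ`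
    -- uses `ℓ ≥ 1/2`.
    have h1 : 1 / τ ≤ X ^ 2 := by
      rw [hX, ← Real.rpow_natCast, ← Real.rpow_mul hτ0.le, one_div, ← Real.rpow_neg_one]
      refine hmono ?_
      have : (p - 1) / (2 * p - 1) ≤ 1 / 2 := by rw [div_le_iff₀ hp2]; linarith
      push_cast
      linarith
    calc L₁ * τ * ℓ / Δ * Δ ^ 2 / τ ^ 2 = L₁ * Δ * (1 / τ) * ℓ := by field_simp
      _ ≤ L₁ * Δ * X ^ 2 * (2 * ℓ) ^ 2 := by gcongr; nlinarith
  have t1 : 0 ≤ (L₂ ^ ((1 : ℝ) / 2) * Δ) ^ ((2 : ℝ) / 3) * τ ^ (-(2 * (p - 1) / (4 * p - 3))) := by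
    positivity
  have t2 : 0 ≤ √(σ₂ * Δ) * τ ^ (-(q * (p - 1) / A)) * √ℓ := by positivity
  have t3 : 0 ≤ s * X * ℓ := by positivity
  have t4 : 0 ≤ σ₁ * X * ℓ := by positivity
  have hfin : (stepScale L₁ L₂ σ₁ σ₂ Δ p q α ℓ T)⁻¹ * Δ / τ ≤
      (√(L₁ / Δ) / α + (L₂ * τ / (Δ * α)) ^ ((1 : ℝ) / 3) + α * τ * ℓ * √(L₁ / Δ) +
      σ₁ * α ^ ((p - 1) / p) * τ * ℓ / Δ + √(σ₂ * τ * ℓ / (Δ * α ^ (1 / q))) +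
      √(L₁ * τ * ℓ / Δ)) * Δ / τ := by gcongr
  simp only [add_mul, add_div] at hfin ⊢
  linarith

end Parameters

/-! ### Final ingredients and assembly. -/

lemma Sampling.ae_mem_Icc {Ω Ξ : Type*} [MeasurableSpace Ω] [MeasurableSpace Ξ] {P : Measure Ω}
    {D : Measure Ξ} [IsProbabilityMeasure D] {u : ℕ → Ω → ℝ} {ξ ξ' : ℕ → Ω → Ξ}
    (h : Sampling P D u ξ ξ') : ∀ᵐ ω ∂P, ∀ t, u t ω ∈ Set.Icc (0 : ℝ) 1 := by
  refine ae_all_iff.2 fun t => ?_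
  have hm : Measurable fun ω => (u t ω, ξ t ω, ξ' t ω) :=
    (h.measurable_u t).prodMk ((h.measurable_grad t).prodMk (h.measurable_hess t))
  have hlaw : P.map (u t) = volume.restrict (Set.Icc (0 : ℝ) 1) := by
    have := congrArg (Measure.map Prod.fst) (h.law t)
    rw [Measure.map_map measurable_fst hm, Measure.map_fst_prod] at this
    rw [measure_univ, one_smul] at this
    exact this
  refine ae_of_ae_map (h.measurable_u t).aemeasurable (p := fun v => v ∈ Set.Icc (0 : ℝ) 1) ?_
  rw [hlaw]
  exact ae_restrict_mem measurableSet_Icc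

lemma rpow_le_mul_rpow_of_le {a b α r : ℝ} (ha : 0 ≤ a) (hα : 0 < α) (hr : 0 < r)
    (h : a * α ^ (-(1 / r)) ≤ b) : a ^ r ≤ α * b ^ r := by
  calc a ^ r = α * (a * α ^ (-(1 / r))) ^ r := by
        rw [Real.mul_rpow ha (by positivity), ← Real.rpow_mul hα.le,
          show -(1 / r) * r = -1 by field_simp, Real.rpow_neg_one]
        field_simp
    _ ≤ _ := by gcongr

/-- Both choices are `log y` with `y ≥ 2` and `y ≥ T/β`. The lower bound `2/3 < log 2` later absorbs
additive constants into `ℓ`, and the second bound is the union bound over `T` times. -/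
lemma log_factor_bounds {T : ℕ} {β ℓ : ℝ} (hT : 1 ≤ T) (hβ : 0 < β) (hβ1 : β ≤ 1)
    (hℓ : ℓ = Real.log (8 * T / β) ∨ (2 ≤ T / β ∧ ℓ = Real.log (T / β))) :
    2 / 3 ≤ ℓ ∧ T * Real.exp (-ℓ) ≤ β := by
  have hT1 : (1 : ℝ) ≤ T := by exact_mod_cast hT
  have hT0 : (0 : ℝ) < T := by linarith
  have h1 : 1 ≤ T / β := (one_le_div hβ).2 (by linarith)
  have key : ∀ y : ℝ, 2 ≤ y → T / β ≤ y → 2 / 3 ≤ Real.log y ∧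
      T * Real.exp (-Real.log y) ≤ β := by
    intro y hy hTy
    have hy0 : 0 < y := by linarith
    constructor
    · have := Real.log_le_log (by norm_num) hy
      have := Real.log_two_gt_d9
      linarith
    · rw [Real.exp_neg, Real.exp_log hy0, ← div_eq_mul_inv, div_le_iff₀ hy0]
      rwa [div_le_iff₀' hβ] at hTy
  rcases hℓ with rfl | ⟨h2, rfl⟩
  · have : (8 * T / β : ℝ) = 8 * (T / β) := by ring
    rw [this]
    exact key _ (by linarith) (by linarith)
  · exact key _ h2 le_rfl

end ClippedHess

end

theorem mainTheorem12 :
    ∃ c₀ : ℝ, 0 < c₀ ∧ ∃ C : ℝ, 0 < C ∧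
      ∀ (d : ℕ) (Ξ : Type*) [MeasurableSpace Ξ] (D : Measure Ξ) [IsProbabilityMeasure D]
        (F : EuclideanSpace ℝ (Fin d) → ℝ)
        (G : EuclideanSpace ℝ (Fin d) → Ξ → EuclideanSpace ℝ (Fin d))
        (H : EuclideanSpace ℝ (Fin d) → Ξ →
          (EuclideanSpace ℝ (Fin d) →L[ℝ] EuclideanSpace ℝ (Fin d)))
        (L₁ L₂ σ₁ σ₂ p q : ℝ),
        BddBelow (Set.range F) →
        0 ≤ L₁ → ClippedHess.GradientLipschitz F L₁ →
        1 < p → p ≤ 2 → 0 < σ₁ → ClippedHess.GradientBCM D F G p σ₁ →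
        0 ≤ L₂ → ClippedHess.HessianLipschitz F L₂ →
        1 ≤ q → q ≤ 2 → 0 < σ₂ → ClippedHess.HessianBCM D F H q σ₂ →
      ∀ (Ω : Type*) [MeasurableSpace Ω] (P : Measure Ω) [IsProbabilityMeasure P]
        (u : ℕ → Ω → ℝ) (ξ ξ' : ℕ → Ω → Ξ),
        ClippedHess.Sampling P D u ξ ξ' →
      ∀ (x₀ : EuclideanSpace ℝ (Fin d)) (T : ℕ) (β ℓ Δ α γ lam₁ lam₂ c : ℝ),
        1 ≤ T → 0 < β → β ≤ 1 →
        -- the logarithmic factor: `log (8 T / β)`, or `log (T / β)` if `T / β ≥ 2`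
        (ℓ = Real.log (8 * T / β) ∨ (2 ≤ T / β ∧ ℓ = Real.log (T / β))) →
        Δ = F x₀ - ⨅ x, F x →
        α = ClippedHess.momentum p q T →
        0 < c → c ≤ c₀ →
        γ = c * ClippedHess.stepScale L₁ L₂ σ₁ σ₂ Δ p q α ℓ T →
        0 < γ →
        lam₁ = max (2 * γ * L₁) (γ * σ₂ * α ^ (-(1 / q))) →
        lam₂ = max (4 * √(L₁ * Δ)) (σ₁ * α ^ (-(1 / p))) →
        1 - β ≤ P.real {ω |
          (1 / (T : ℝ)) * ∑ t ∈ Finset.range T, ‖gradient F (ClippedHess.iterate G H γ α lam₁ lam₂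
              x₀ 0 (fun s => u s ω) (fun s => ξ s ω) (fun s => ξ' s ω) t)‖ ≤ 2 * Δ / (γ * T) ∧
          (1 / (T : ℝ)) * ∑ t ∈ Finset.range T, ‖gradient F (ClippedHess.iterate G H γ α lam₁ lam₂
              x₀ 0 (fun s => u s ω) (fun s => ξ s ω) (fun s => ξ' s ω) t)‖ ≤
            C / c * ClippedHess.rate L₁ L₂ σ₁ σ₂ Δ p q ℓ T} := by
  refine ⟨1 / 400, by norm_num, 12, by norm_num, ?_⟩
  intro d Ξ _ D _ F G H L₁ L₂ σ₁ σ₂ p q hb hL₁ hF1 hp hp2 hσ₁ hG hL₂ hF2 hq hq2 hσ₂ hH Ω _ P _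
    u ξ ξ' hsamp x₀ T β ℓ Δ α γ lam₁ lam₂ c hT hβ hβ1 hℓ hΔ hα hc hc0 hγ hγ0 hlam₁ hlam₂
  obtain ⟨hℓ1, hℓT⟩ := ClippedHess.log_factor_bounds hT hβ hβ1 hℓ
  have hT0 : (0 : ℝ) < T := by exact_mod_cast hT
  have hα0 : 0 < α := hα ▸ ClippedHess.momentum_pos hT
  have hα1 : α ≤ 1 := hα ▸ ClippedHess.momentum_le_one hT hp hq
  have hΔ0 : 0 < Δ := by
    refine lt_of_le_of_ne (hΔ ▸ sub_nonneg.2 (ciInf_le hb x₀)) ?_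
    rintro rfl
    rw [ClippedHess.stepScale_of_zero_gap, mul_zero] at hγ
    exact hγ0.ne' hγ
  have hl₁ : 0 < lam₁ := hlam₁ ▸ lt_max_of_lt_right (by positivity)
  have hl₂ : 0 < lam₂ := hlam₂ ▸ lt_max_of_lt_right (by positivity)
  have hσl₁ : (γ * σ₂) ^ q ≤ α * lam₁ ^ q :=
    ClippedHess.rpow_le_mul_rpow_of_le (by positivity) hα0 (by linarith) (hlam₁ ▸ le_max_right _ _)
  have hσl₂ : σ₁ ^ p ≤ α * lam₂ ^ p :=
    ClippedHess.rpow_le_mul_rpow_of_le hσ₁.le hα0 (by linarith) (hlam₂ ▸ le_max_right _ _)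
  set B := 21 * ℓ * (lam₁ + α * lam₂) with hB
  -- Since `ℓ ≥ 2/3`, `4 + ℓ ≤ 7ℓ`; this is the source of the constant `21`.
  have hBR : 3 * (lam₁ + α * lam₂) * (4 + ℓ) ≤ B := by
    have : 0 < lam₁ + α * lam₂ := by positivity
    rw [hB]
    nlinarith
  have hbudget := ClippedHess.total_error_le (a := ‖gradient F x₀‖) hL₁ hL₂ hσ₁ hσ₂ hΔ0 hp hα0
    (by linarith) hT hc hc0 hγ0 hγ (hΔ ▸ hF1.norm_gradient_sq_le hL₁ hb x₀) hlam₁ hlam₂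
  have hrate := ClippedHess.gap_mul_inv_stepScale_le (ℓ := ℓ) hL₁ hL₂ hσ₁ hσ₂ hΔ0 hp hq hα
    (by linarith) hT
  have hγrate : 2 * Δ / (γ * T) ≤ 12 / c * ClippedHess.rate L₁ L₂ σ₁ σ₂ Δ p q ℓ T := by
    calc 2 * Δ / (γ * T)
        = 2 / c * ((ClippedHess.stepScale L₁ L₂ σ₁ σ₂ Δ p q α ℓ T)⁻¹ * Δ / T) := by
          rw [hγ, div_eq_mul_inv, mul_inv, mul_inv]
          ring
      _ ≤ 2 / c * (6 * ClippedHess.rate L₁ L₂ σ₁ σ₂ Δ p q ℓ T) := by gcongr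
      _ = _ := by ring
  set good : Set Ω := {ω | _} with hgood
  set bad : Set Ω := ⋃ t ∈ Finset.range T, {ω | 3 * (lam₁ + α * lam₂) * (4 + ℓ) ≤
    ‖ClippedHess.noiseSum F G H γ α lam₁ lam₂ x₀ (fun s => u s ω) (fun s => ξ s ω)
      (fun s => ξ' s ω) t‖} with hbad
  have hPbad : P bad ≤ ENNReal.ofReal β := by
    calc P bad ≤ ∑ t ∈ Finset.range T, ENNReal.ofReal (Real.exp (-ℓ)) :=
          (measure_biUnion_finset_le _ _).trans (Finset.sum_le_sum fun t _ =>
            ClippedHess.measure_noiseSum_ge_le hF1 hL₁ hF2 hG hp.le hp2 hH hq hq2 hσ₂.le hsamp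
              hα0.le hα1 hγ0.le hl₁ hl₂ hσl₁ hσl₂ (hlam₁ ▸ le_max_left _ _) x₀ t ℓ)
      _ = ENNReal.ofReal (T * Real.exp (-ℓ)) := by
          rw [Finset.sum_const, Finset.card_range, nsmul_eq_mul, ENNReal.ofReal_mul hT0.le,
            ENNReal.ofReal_natCast]
      _ ≤ ENNReal.ofReal β := ENNReal.ofReal_le_ofReal hℓT
  -- The inclusion is only almost sure, because the `u_t` lie in `[0, 1]` only almost surely.
  have hsub : goodᶜ ≤ᵐ[P] bad := by
    filter_upwards [hsamp.ae_mem_Icc] with ω hω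
    refine fun hng => by_contra fun hnb => hng ?_
    have hS : ∀ t < T, ‖ClippedHess.noiseSum F G H γ α lam₁ lam₂ x₀ (fun s => u s ω)
        (fun s => ξ s ω) (fun s => ξ' s ω) t‖ ≤ B := by
      intro t ht
      refine le_trans (le_of_not_ge fun h => hnb ?_) hBR
      exact Set.mem_biUnion (Finset.mem_range.2 ht) h
    have hsum := ClippedHess.sum_norm_gradient_le hb hF1 hL₁ hF2 hL₂ hγ0.le hα0 hα1 hω hΔ
      (by positivity) hS (hlam₂ ▸ le_max_left _ _) hbudget
    have hfirst : (1 / (T : ℝ)) * ∑ t ∈ Finset.range T, ‖gradient F (ClippedHess.iterate G H γ α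
        lam₁ lam₂ x₀ 0 (fun s => u s ω) (fun s => ξ s ω) (fun s => ξ' s ω) t)‖ ≤
        2 * Δ / (γ * T) := by
      rw [one_div, inv_mul_le_iff₀ hT0,
        show (T : ℝ) * (2 * Δ / (γ * T)) = 2 * Δ / γ by field_simp, le_div_iff₀' hγ0]
      exact hsum
    exact ⟨hfirst, hfirst.trans hγrate⟩
  have hcompl : P.real goodᶜ ≤ β := by
    refine ENNReal.toReal_le_of_le_ofReal hβ.le ((measure_mono_ae hsub).trans hPbad)
  -- Subadditivity suffices here, so measurability of `good` plays no role.
  have huniv : 1 ≤ P.real good + P.real goodᶜ := by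
    have h := measureReal_union_le (μ := P) good goodᶜ
    rwa [Set.union_compl_self, probReal_univ] at h
  linarith
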